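/- For $r\ge 1$ and positive integers $k_1,\dots,k_r$ let $$\bar T(k_1,\dots,k_r)=\lim_{N\to\infty}2^r\sum_{0<n_1<\cdots<n_r\le N}\frac{(-1)^{n_r}}{(2n_1-1)^{k_1}(2n_2-2)^{k_2}\cdots(2n_r-r)^{k_r}},$$ and let $W(k,r)=\sum\bar T(k_1,\dots,k_r)$, where the sum is over all $r$-tuples of positive integers with $k_1+\cdots+k_r=k$. Let $\zeta(k)=\sum_{n\ge1}n^{-k}$ for $k\ge2$, let $\bar\zeta(k)=\sum_{n\ge1}(-1)^{n-1}n^{-k}$ for $k\ge1$, and $\bar\zeta(0)=\tfrac12$. For $1\le j\le p$ let $Z(p,p)=1$ and, if $j<p$, $$Z(j,p)=\sum_{k=1}^{p-j}(-2)^k\sum_{j=i_0<i_1<\cdots<i_k=p}\ \prod_{l=1}^k\bar\zeta(2i_l-2i_{l-1}).$$ **Corollary 3.5.** Let $p$ be a positive integer. All the limits $\bar T(k_1,\dots,k_{2p})$ occurring in $W(2p+1,2p)$ exist, and $W(2p+1,2p)$ can be expressed in terms of Riemann zeta values and alternating zeta values: it is a polynomial with rational coefficients in the numbers $\zeta(k)$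 $(k\ge2)$ and $\bar\zeta(k)$ $(k\ge1)$. Explicitly, $$W(2p+1,2p)=(-1)^{p-1}\sum_{j=1}^{p}\left(\frac1{2^{2j-1}}\sum_{i=1}^{j}\bigl(2^{2i+1}-1\bigr)\,\zeta(2i+1)\,\bar\zeta(2j-2i)\right)Z(j,p).$$ -/

import Mathlib

open Filter Topology

noncomputable section

namespace AltMTV

/-- The finite sets `I(k, r)`: all indices `(k₁, …, k_r)` of positive integers
with `k₁ + ⋯ + k_r = k`. -/
def indices (k r : ℕ) : Finset (Fin r → ℕ) :=
  (Finset.Nat.antidiagonalTuple r k).filter fun κ => ∀ j, 1 ≤ κ j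

/-- The strictly increasing sequences `0 < n₁ < ⋯ < n_r ≤ N`. -/
def chains (r N : ℕ) : Finset (Fin r → ℕ) :=
  open Classical in (Fintype.piFinset fun _ => Finset.Icc 1 N).filter StrictMono

/-- Partial sums (over `n_r ≤ N`) of the alternating multiple `T`-value, i.e.
`2^r ∑_{0 < n₁ < ⋯ < n_r ≤ N} (-1)^{n_r} / ((2n₁-1)^{k₁} (2n₂-2)^{k₂} ⋯ (2n_r-r)^{k_r})`.
The indices `j : Fin r` start at `0`, so the usual one-based index is `j + 1`; the sign is
attached to the last one only. -/
def tBarPartial {r : ℕ} (κ : Fin r → ℕ) (N : ℕ) : ℝ :=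
  2 ^ r * ∑ n ∈ chains r N, ∏ j : Fin r,
    (if (j : ℕ) + 1 = r then (-1 : ℝ) ^ n j else 1) / (2 * (n j : ℝ) - ((j : ℝ) + 1)) ^ κ j

/-- The alternating multiple `T`-value `T̄(k₁, …, k_r)`: the limit of the partial sums.
(When `k_r = 1` the series converges only conditionally.) -/
def tBar {r : ℕ} (κ : Fin r → ℕ) : ℝ :=
  limUnder atTop (tBarPartial κ)

/-- The weighted sum `W(k, r) = W₁(k, r)`: the sum of `T̄` over all indices of weight `k` and
depth `r` (all the weights are `binom(k_r - 1, 0) = 1`). -/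
def W (k r : ℕ) : ℝ :=
  ∑ κ ∈ indices k r, tBar κ

/-- The Riemann zeta value `ζ(k) = ∑_{n ≥ 1} 1 / n^k`, used for `k ≥ 2`
(the term at `n = 0` is `1 / 0 = 0`). -/
def zetaVal (k : ℕ) : ℝ :=
  ∑' n : ℕ, 1 / (n : ℝ) ^ k

/-- `zetaVal` agrees with Mathlib's Riemann zeta function. -/
theorem zetaVal_eq {k : ℕ} (hk : 2 ≤ k) : (zetaVal k : ℂ) = riemannZeta k := by
  rw [zeta_nat_eq_tsum_of_gt_one hk, zetaVal]
  push_cast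
  rfl

/-- Partial sums of the alternating zeta series. -/
def zetaBarPartial (k N : ℕ) : ℝ :=
  ∑ n ∈ Finset.Icc 1 N, (-1 : ℝ) ^ (n - 1) / (n : ℝ) ^ k

/-- The alternating zeta value `ζ̄(k) = ∑_{n ≥ 1} (-1)^{n-1} / n^k` for `k ≥ 1`, as the limit of
the partial sums, with the convention `ζ̄(0) = 1/2`. -/
def zetaBar (k : ℕ) : ℝ :=
  if k = 0 then 1 / 2 else limUnder atTop (zetaBarPartial k)

/-- The alternating zeta series converges to `zetaBar k` for every `k ≥ 1`. -/
theorem tendsto_zetaBarPartial {k : ℕ} (hk : 1 ≤ k) :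
    Tendsto (zetaBarPartial k) atTop (𝓝 (zetaBar k)) := by
  have hk0 : k ≠ 0 := by omega
  rw [zetaBar, if_neg hk0]
  apply tendsto_nhds_limUnder
  have hanti : Antitone fun n : ℕ => 1 / ((n : ℝ) + 1) ^ k := by
    intro a b hab
    have hab' : (a : ℝ) ≤ b := by exact_mod_cast hab
    dsimp only
    gcongr
  have hlim : Tendsto (fun n : ℕ => 1 / ((n : ℝ) + 1) ^ k) atTop (𝓝 0) := by
    have h := (tendsto_one_div_add_atTop_nhds_zero_nat (𝕜 := ℝ)).pow k
    simpa [hk0] using h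
  obtain ⟨l, hl⟩ := hanti.tendsto_alternating_series_of_tendsto_zero hlim
  refine ⟨l, hl.congr fun N => ?_⟩
  rw [zetaBarPartial, Finset.range_eq_Ico, ← Finset.Ico_succ_right_eq_Icc,
    Finset.sum_Ico_eq_sum_range, Finset.sum_Ico_eq_sum_range]
  refine Finset.sum_congr (by simp) fun n _ => ?_
  simp [div_eq_mul_inv, add_comm]

/-- The chains `j = i₀ < i₁ < ⋯ < i_k = p`. -/
def linkedChains (k j p : ℕ) : Finset (Fin (k + 1) → ℕ) :=
  open Classical in (Fintype.piFinset fun _ => Finset.Icc j p).filter fun i =>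
    StrictMono i ∧ i 0 = j ∧ i (Fin.last k) = p

/-- The numbers `Z(j, p)` for `1 ≤ j ≤ p`:
`Z(j, p) = ∑_{k=1}^{p-j} (-2)^k ∑_{j = i₀ < i₁ < ⋯ < i_k = p} ∏_{l=1}^k ζ̄(2 i_l - 2 i_{l-1})`
for `j < p`, and `Z(p, p) = 1`. -/
def Z (j p : ℕ) : ℝ :=
  if j = p then 1
  else ∑ k ∈ Finset.Icc 1 (p - j), (-2 : ℝ) ^ k *
    ∑ i ∈ linkedChains k j p, ∏ l : Fin k, zetaBar (2 * i l.succ - 2 * i l.castSucc)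

end AltMTV

end

/-!
Write `Φᵣ(t)` for the power series whose coefficients are the terms of `W(r + 1, r)` grouped by
`n_r`, so that Abel's theorem gives `W(r + 1, r) = Φᵣ(1⁻)`. The analogous series of the sums with
all exponents equal to `1` is `(-2 arctan t)ʳ / r!`. In the variable `t = tan (θ / 2)` the recursion
of the partial sums becomes `Φᵣ' = (-θ)ʳ / (r! sin θ) - Φᵣ₋₁`, and variation of parameters gives
`(-1)ʳ W(r + 1, r) = ∫ ((π/2)ʳ - (π/2 - θ)ʳ) / (r! sin θ) dθ` over `[0, π/2]`.

By the Riemann–Lebesgue lemma, `1 / sin θ` may be replaced by `∑ 2 sin ((2q + 1) θ)`. Integrating by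
parts twice reduces each sine moment to the one of degree smaller by two, and for `r = 2p` the sum
over `q` is `(-1)^(p-1)` times the coefficient of `x^(p-1)` in the product of a series of odd zeta
values and `cosh √(-(π/2)² x)`.

Finally, Euler's formula for `ζ̄(2n)` says that `∑ 2 ζ̄(2n) xⁿ` is the inverse of
`sinh √(-π² x) / √(-π² x)`, so `Z(j, p)` is the coefficient of `x^(p-j)` in the latter, and the
duplication formula `sinh 2y = 2 sinh y cosh y` factors the `cosh` series into the two series
appearing in the explicit formula.
-/

namespace AltMTV

open scoped Real
open Finset.HasAntidiagonal (antidiagonal)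

section BernoulliSeries

open PowerSeries

/-- The series `∑ f₂ₙ Xⁿ` of the even coefficients of `f`. -/
noncomputable def evenPart {R : Type*} [Semiring R] (f : R⟦X⟧) : R⟦X⟧ :=
  PowerSeries.mk fun n => coeff (2 * n) f

/-- The series `∑ f₂ₙ₊₁ Xⁿ` of the odd coefficients of `f`. -/
noncomputable def oddPart {R : Type*} [Semiring R] (f : R⟦X⟧) : R⟦X⟧ :=
  PowerSeries.mk fun n => coeff (2 * n + 1) f

theorem sum_range_two_mul {M : Type*} [AddCommMonoid M] (f : ℕ → M) (n : ℕ) :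
    ∑ i ∈ Finset.range (2 * n), f i = ∑ i ∈ Finset.range n, (f (2 * i) + f (2 * i + 1)) := by
  induction n with
  | zero => simp
  | succ n ih =>
    rw [show 2 * (n + 1) = 2 * n + 1 + 1 by ring, Finset.sum_range_succ, Finset.sum_range_succ, ih,
      Finset.sum_range_succ _ n, add_assoc]

theorem oddPart_mul_of_evenPart_eq_zero {R : Type*} [Semiring R] {f g : R⟦X⟧}
    (hg : evenPart g = 0) : oddPart (f * g) = evenPart f * oddPart g := by
  have hg' (n : ℕ) : coeff (2 * n) g = 0 := by simpa [evenPart] using congrArg (coeff n) hg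
  ext n
  simp only [oddPart, evenPart, coeff_mk, coeff_mul,
    Finset.Nat.sum_antidiagonal_eq_sum_range_succ_mk]
  rw [show (2 * n + 1).succ = 2 * n.succ by omega, sum_range_two_mul]
  refine Finset.sum_congr rfl fun i hi => ?_
  have hin : i ≤ n := Finset.mem_range_succ_iff.1 hi
  rw [show 2 * n + 1 - 2 * i = 2 * (n - i) + 1 by omega,
    show 2 * n + 1 - (2 * i + 1) = 2 * (n - i) by omega, hg', mul_zero, add_zero]

/-- The series of `sinh √x / √x`. -/
noncomputable def sinhcSeries : ℝ⟦X⟧ :=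
  PowerSeries.mk fun n => ((2 * n + 1).factorial : ℝ)⁻¹

/-- The series of `cosh √x`. -/
noncomputable def coshSeries : ℝ⟦X⟧ :=
  PowerSeries.mk fun n => ((2 * n).factorial : ℝ)⁻¹

/-- The series of `2 sinh (a x)`. -/
noncomputable def twoSinhSeries (a : ℝ) : ℝ⟦X⟧ :=
  rescale a (exp ℝ) - rescale (-a) (exp ℝ)

theorem coeff_exp_real (n : ℕ) : coeff n (exp ℝ) = (n.factorial : ℝ)⁻¹ := by
  simp [coeff_exp]

theorem evenPart_twoSinhSeries (a : ℝ) : evenPart (twoSinhSeries a) = 0 := by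
  ext n
  simp [evenPart, twoSinhSeries]

theorem oddPart_twoSinhSeries (a : ℝ) :
    oddPart (twoSinhSeries a) = C (2 * a) * rescale (a ^ 2) sinhcSeries := by
  ext n
  simp only [oddPart, twoSinhSeries, sinhcSeries, coeff_mk, map_sub, coeff_exp_real,
    coeff_C_mul, coeff_rescale, Odd.neg_pow ⟨n, rfl⟩]
  ring

theorem sinhcSeries_mul_coshSeries :
    sinhcSeries * coshSeries = rescale (4 : ℝ) sinhcSeries := by
  have double_angle : (exp ℝ + rescale (-1 : ℝ) (exp ℝ)) * twoSinhSeries 1 = twoSinhSeries 2 := by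
    have h2 : rescale (2 : ℝ) (exp ℝ) = exp ℝ * exp ℝ := by
      simpa [one_add_one_eq_two] using (exp_mul_exp_eq_exp_add (1 : ℝ) 1).symm
    have h2' : rescale (-2 : ℝ) (exp ℝ) = rescale (-1 : ℝ) (exp ℝ) * rescale (-1 : ℝ) (exp ℝ) := by
      rw [exp_mul_exp_eq_exp_add]; norm_num
    rw [twoSinhSeries, twoSinhSeries, h2, h2', rescale_one, RingHom.id_apply]
    ring
  have even_sum : evenPart (exp ℝ + rescale (-1 : ℝ) (exp ℝ)) = C 2 * coshSeries := by
    ext n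
    simp only [evenPart, coshSeries, coeff_mk, map_add, coeff_rescale, coeff_exp_real,
      coeff_C_mul, Even.neg_one_pow ⟨n, two_mul n⟩]
    ring
  have h := oddPart_mul_of_evenPart_eq_zero (f := exp ℝ + rescale (-1 : ℝ) (exp ℝ))
    (evenPart_twoSinhSeries 1)
  rw [double_angle, even_sum, oddPart_twoSinhSeries, oddPart_twoSinhSeries] at h
  have h_four : C (2 * 2 : ℝ) * rescale (2 ^ 2 : ℝ) sinhcSeries =
      C (2 * 2 : ℝ) * (sinhcSeries * coshSeries) := by
    rw [h, mul_one, one_pow, rescale_one, RingHom.id_apply, map_mul]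
    ring
  rw [show (4 : ℝ) = 2 ^ 2 by norm_num]
  exact (mul_left_cancel₀ (by simp) h_four).symm

/-- The series `∑ Bₙ(1/2) Xⁿ / n!`. -/
noncomputable def halfBernoulliSeries : ℝ⟦X⟧ :=
  PowerSeries.mk fun n =>
    Polynomial.aeval (1 / 2 : ℝ) ((1 / n.factorial : ℚ) • Polynomial.bernoulli n)

theorem halfBernoulliSeries_mul_twoSinhSeries :
    halfBernoulliSeries * twoSinhSeries (1 / 2) = X := by
  have h_exp : twoSinhSeries (1 / 2) = (exp ℝ - 1) * rescale (-(1 / 2) : ℝ) (exp ℝ) := by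
    have h := exp_mul_exp_eq_exp_add (1 : ℝ) (-(1 / 2))
    rw [rescale_one, RingHom.id_apply, show (1 : ℝ) + -(1 / 2) = 1 / 2 by norm_num] at h
    rw [twoSinhSeries, ← h]
    ring
  have h_inv : rescale (1 / 2 : ℝ) (exp ℝ) * rescale (-(1 / 2) : ℝ) (exp ℝ) = 1 := by
    simp [exp_mul_exp_eq_exp_add]
  rw [h_exp, ← mul_assoc, halfBernoulliSeries, Polynomial.bernoulli_generating_function, mul_assoc,
    h_inv, mul_one]

theorem evenPart_halfBernoulliSeries_mul :
    evenPart halfBernoulliSeries * rescale (1 / 4 : ℝ) sinhcSeries = 1 := by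
  have h := oddPart_mul_of_evenPart_eq_zero (f := halfBernoulliSeries)
    (evenPart_twoSinhSeries (1 / 2))
  have h_one : oddPart (X : ℝ⟦X⟧) = 1 := by
    ext n
    simp [oddPart, coeff_X, coeff_one]
  rw [halfBernoulliSeries_mul_twoSinhSeries, h_one, oddPart_twoSinhSeries,
    mul_one_div_cancel two_ne_zero, map_one, one_mul, show (1 / 2 : ℝ) ^ 2 = 1 / 4 by norm_num] at h
  exact h.symm

theorem sum_Icc_one_eq_sum_range {M : Type*} [AddCommMonoid M] (f : ℕ → M) (n : ℕ) :
    ∑ i ∈ Finset.Icc 1 n, f i = ∑ i ∈ Finset.range n, f (i + 1) := by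
  rw [← Finset.Ico_succ_right_eq_Icc, Finset.sum_Ico_eq_sum_range]
  simp [add_comm]

theorem tendsto_sum_Icc_one_of_hasSum {M : Type*} [AddCommMonoid M] [TopologicalSpace M]
    {f : ℕ → M} {l : M} (h0 : f 0 = 0) (h : HasSum f l) :
    Tendsto (fun N => ∑ n ∈ Finset.Icc 1 N, f n) atTop (𝓝 l) := by
  refine ((tendsto_add_atTop_iff_nat 1).2 h.tendsto_sum_nat).congr fun N => ?_
  rw [Finset.sum_range_succ', h0, add_zero, sum_Icc_one_eq_sum_range]

theorem zetaBar_two_mul (n : ℕ) :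
    zetaBar (2 * n) = (-1) ^ n * (2 * π) ^ (2 * n) / 2 *
      coeff (2 * n) halfBernoulliSeries := by
  rcases Nat.eq_zero_or_pos n with rfl | hn
  · simp [zetaBar, halfBernoulliSeries]
  have h_sum := hasSum_one_div_nat_pow_mul_cos hn.ne' (x := 1 / 2) (by norm_num)
  have h_tendsto := tendsto_sum_Icc_one_of_hasSum (by simp [hn.ne']) h_sum.neg
  refine tendsto_nhds_unique (tendsto_zetaBarPartial (by omega)) ?_
  convert h_tendsto using 1
  · ext N
    refine Finset.sum_congr rfl fun m hm => ?_
    obtain ⟨k, rfl⟩ : ∃ k, m = k + 1 := ⟨m - 1, by have := (Finset.mem_Icc.1 hm).1; omega⟩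
    rw [show 2 * π * ((k + 1 : ℕ) : ℝ) * (1 / 2) = ((k + 1 : ℕ) : ℝ) * π by ring,
      Real.cos_nat_mul_pi, Nat.add_sub_cancel]
    ring
  · rw [halfBernoulliSeries, coeff_mk, map_smul, Polynomial.eval_map_algebraMap, Rat.smul_def]
    push_cast
    ring_nf

/-- The generating series `∑ 2 ζ̄(2n) Xⁿ`; its constant coefficient is `1` since
`ζ̄(0) = 1/2`. -/
noncomputable def zetaBarSeries : ℝ⟦X⟧ :=
  PowerSeries.mk fun n => 2 * zetaBar (2 * n)

theorem zetaBarSeries_eq_rescale :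
    zetaBarSeries = rescale (-(2 * π) ^ 2) (evenPart halfBernoulliSeries) := by
  ext n
  rw [zetaBarSeries, evenPart, coeff_mk, coeff_rescale, coeff_mk, zetaBar_two_mul,
    neg_pow ((2 * π) ^ 2), ← pow_mul]
  ring

theorem zetaBarSeries_mul_rescale_sinhcSeries :
    zetaBarSeries * rescale (-π ^ 2) sinhcSeries = 1 := by
  have h := congrArg (rescale (-(2 * π) ^ 2)) evenPart_halfBernoulliSeries_mul
  rw [map_mul, map_one, rescale_rescale, ← zetaBarSeries_eq_rescale] at h
  convert h using 4
  ring

theorem rescale_zetaBarSeries_mul_rescale_sinhcSeries :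
    rescale (1 / 4 : ℝ) zetaBarSeries * rescale (-π ^ 2) sinhcSeries =
      rescale (-(π / 2) ^ 2) coshSeries := by
  have h_inv := congrArg (rescale (1 / 4 : ℝ)) zetaBarSeries_mul_rescale_sinhcSeries
  rw [map_mul, map_one, rescale_rescale,
    show -π ^ 2 * (1 / 4) = -(π / 2) ^ 2 by ring] at h_inv
  have h_double := congrArg (rescale (-(π / 2) ^ 2)) sinhcSeries_mul_coshSeries
  rw [map_mul, rescale_rescale,
    show 4 * -(π / 2) ^ 2 = -π ^ 2 by ring] at h_double
  rw [← h_double, ← mul_assoc, h_inv, one_mul]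

end BernoulliSeries

section LinkedChains

open PowerSeries

theorem mem_linkedChains {k j p : ℕ} {i : Fin (k + 1) → ℕ} :
    i ∈ linkedChains k j p ↔ StrictMono i ∧ i 0 = j ∧ i (Fin.last k) = p := by
  simp only [linkedChains, Finset.mem_filter, Fintype.mem_piFinset, Finset.mem_Icc,
    and_iff_right_iff_imp]
  rintro ⟨h, rfl, rfl⟩ a
  exact ⟨h.monotone (Fin.zero_le a), h.monotone (Fin.le_last a)⟩

theorem linkedChains_zero (j p : ℕ) :
    linkedChains 0 j p = if j = p then {fun _ => j} else ∅ := by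
  ext i
  have h_mono : StrictMono i := Fin.strictMono_iff_lt_succ.2 fun a => a.elim0
  have h_mem : i ∈ linkedChains 0 j p ↔ i 0 = j ∧ i 0 = p := by
    rw [mem_linkedChains, and_iff_right h_mono]
    rfl
  rw [h_mem]
  split_ifs with h
  · subst h
    simp [funext_iff]
  · simp only [Finset.notMem_empty, iff_false]
    rintro ⟨h₀, h₁⟩
    exact h (h₀.symm.trans h₁)

theorem sum_linkedChains_succ {M : Type*} [AddCommMonoid M] (k j p : ℕ)
    (g : (Fin (k + 2) → ℕ) → M) :
    ∑ i ∈ linkedChains (k + 1) j p, g i =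
      ∑ m ∈ Finset.Ioc j p, ∑ i ∈ linkedChains k m p, g (Fin.cons j i) := by
  rw [Finset.sum_sigma']
  refine Finset.sum_bij' (fun i _ => ⟨i 1, Fin.tail i⟩) (fun x _ => Fin.cons j x.2) ?_ ?_ ?_ ?_ ?_
  · intro i hi
    obtain ⟨h_mono, rfl, rfl⟩ := mem_linkedChains.1 hi
    exact Finset.mem_sigma.2 ⟨Finset.mem_Ioc.2 ⟨h_mono (by simp), h_mono.monotone (Fin.le_last _)⟩,
      mem_linkedChains.2 ⟨h_mono.comp Fin.strictMono_succ, rfl, rfl⟩⟩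
  · rintro ⟨m, i⟩ hx
    obtain ⟨hm, hi⟩ := Finset.mem_sigma.1 hx
    dsimp only at hm hi
    obtain ⟨h_mono, rfl, h_last⟩ := mem_linkedChains.1 hi
    refine mem_linkedChains.2 ⟨Fin.strictMono_cons.2 ⟨fun a => ?_, h_mono⟩, rfl, h_last⟩
    exact (Finset.mem_Ioc.1 hm).1.trans_le (h_mono.monotone (Fin.zero_le a))
  · intro i hi
    obtain ⟨-, rfl, -⟩ := mem_linkedChains.1 hi
    exact Fin.cons_self_tail i
  · rintro ⟨m, i⟩ hx
    have hi : i ∈ linkedChains k m p := (Finset.mem_sigma.1 hx).2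
    obtain ⟨-, rfl, -⟩ := mem_linkedChains.1 hi
    rfl
  · intro i hi
    obtain ⟨-, rfl, -⟩ := mem_linkedChains.1 hi
    exact congrArg g (Fin.cons_self_tail i).symm

theorem sum_linkedChains_prod_coeff {R : Type*} [CommSemiring R] {f : R⟦X⟧}
    (hf : constantCoeff f = 0) (k : ℕ) {j p : ℕ} (hjp : j ≤ p) :
    ∑ i ∈ linkedChains k j p, ∏ l : Fin k, coeff (i l.succ - i l.castSucc) f =
      coeff (p - j) (f ^ k) := by
  induction k generalizing j with
  | zero =>
    rw [linkedChains_zero, pow_zero, coeff_one]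
    by_cases h : j = p
    · simp [h]
    · simp [h, show ¬p - j = 0 by omega]
  | succ k ih =>
    have hstep : ∀ m ∈ Finset.Ioc j p, (∑ i ∈ linkedChains k m p, ∏ l : Fin (k + 1),
        coeff ((Fin.cons j i : Fin (k + 2) → ℕ) l.succ -
          (Fin.cons j i : Fin (k + 2) → ℕ) l.castSucc) f) =
        coeff (m - j) f * coeff (p - m) (f ^ k) := by
      intro m hm
      rw [← ih (Finset.mem_Ioc.1 hm).2, Finset.mul_sum]
      refine Finset.sum_congr rfl fun i hi => ?_
      obtain ⟨-, rfl, -⟩ := mem_linkedChains.1 hi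
      simp [Fin.prod_univ_succ]
    rw [sum_linkedChains_succ, Finset.sum_congr rfl hstep, pow_succ', coeff_mul,
      Finset.Nat.sum_antidiagonal_eq_sum_range_succ_mk, Finset.sum_range_succ',
      coeff_zero_eq_constantCoeff_apply f, hf, zero_mul, add_zero,
      ← Finset.Ico_succ_succ_eq_Ioc, Finset.sum_Ico_eq_sum_range]
    refine Finset.sum_congr (by simp) fun a _ => ?_
    congr 3 <;> simp <;> omega

theorem coeff_sum_range_pow_eq {R : Type*} [CommRing R] {f g : R⟦X⟧}
    (hf : constantCoeff f = 0) (hg : (1 - f) * g = 1) {m n : ℕ} (hmn : m < n) :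
    coeff m (∑ k ∈ Finset.range n, f ^ k) = coeff m g := by
  have h_geom : ∑ k ∈ Finset.range n, f ^ k = g - f ^ n * g := by
    calc ∑ k ∈ Finset.range n, f ^ k
        = (∑ k ∈ Finset.range n, f ^ k) * (1 - f) * g := by rw [mul_assoc, hg, mul_one]
      _ = g - f ^ n * g := by rw [geom_sum_mul_neg]; ring
  have h_dvd : X ^ n ∣ f ^ n * g := (pow_dvd_pow_of_dvd (X_dvd_iff.2 hf) n).mul_right g
  rw [h_geom, map_sub, X_pow_dvd_iff.1 h_dvd m hmn, sub_zero]

theorem Z_eq_coeff {j p : ℕ} (hjp : j ≤ p) :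
    Z j p = coeff (p - j) (rescale (-π ^ 2) sinhcSeries) := by
  have hf : constantCoeff (1 - zetaBarSeries) = 0 := by
    rw [← coeff_zero_eq_constantCoeff_apply]
    simp [zetaBarSeries, zetaBar]
  have h_term (k : ℕ) : (-2 : ℝ) ^ k *
      ∑ i ∈ linkedChains k j p, ∏ l : Fin k, zetaBar (2 * i l.succ - 2 * i l.castSucc) =
      coeff (p - j) ((1 - zetaBarSeries) ^ k) := by
    rw [← sum_linkedChains_prod_coeff hf k hjp, Finset.mul_sum]
    refine Finset.sum_congr rfl fun i hi => ?_
    rw [← Fin.prod_const, ← Finset.prod_mul_distrib]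
    refine Finset.prod_congr rfl fun l _ => ?_
    have hl : i l.castSucc < i l.succ := (mem_linkedChains.1 hi).1 (Fin.castSucc_lt_succ)
    simp [zetaBarSeries, coeff_one, Nat.mul_sub, Nat.sub_ne_zero_of_lt hl]
  rw [← coeff_sum_range_pow_eq hf (by rw [sub_sub_cancel, zetaBarSeries_mul_rescale_sinhcSeries])
    (Nat.lt_succ_self _), Z]
  split_ifs with h
  · simp [h]
  · have h_ne : p - j ≠ 0 := by omega
    rw [Finset.sum_congr rfl fun k _ => h_term k, map_sum, Finset.sum_range_succ', pow_zero,
      coeff_one, if_neg h_ne, add_zero, sum_Icc_one_eq_sum_range]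

theorem Z_mem {A : Subalgebra ℚ ℝ} (h : ∀ n, zetaBar n ∈ A) (j p : ℕ) : Z j p ∈ A := by
  rw [Z]
  split_ifs
  · exact A.one_mem
  · have h_two : (-2 : ℝ) ∈ A := A.neg_mem (ofNat_mem A 2)
    exact A.sum_mem fun k _ => A.mul_mem (A.pow_mem h_two k) (A.sum_mem fun i _ =>
      A.prod_mem fun l _ => h _)

end LinkedChains

section Chains

theorem mem_chains {r N : ℕ} {n : Fin r → ℕ} :
    n ∈ chains r N ↔ (∀ j, 1 ≤ n j ∧ n j ≤ N) ∧ StrictMono n := by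
  simp [chains]

theorem chains_zero (N : ℕ) : chains 0 N = {Fin.elim0} := by
  ext n
  rw [mem_chains, Finset.mem_singleton]
  exact ⟨fun _ => Subsingleton.elim _ _, fun _ => ⟨fun j => j.elim0, fun j => j.elim0⟩⟩

theorem chains_eq_empty {r N : ℕ} (h : N < r) : chains r N = ∅ := by
  refine Finset.eq_empty_of_forall_notMem fun n hn => ?_
  obtain ⟨h_mem, h_mono⟩ := mem_chains.1 hn
  have h_card : r ≤ N := by
    simpa using Finset.card_le_card_of_injOn (s := Finset.univ) (t := Finset.Icc 1 N) n
      (fun j _ => by simpa using h_mem j) h_mono.injective.injOn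
  omega

theorem strictMono_snoc {α : Type*} [Preorder α] {r : ℕ} {f : Fin r → α} {a : α}
    (hf : StrictMono f) (ha : ∀ j, f j < a) :
    StrictMono (Fin.snoc f a : Fin (r + 1) → α) := by
  intro i j hij
  obtain ⟨i, rfl⟩ := Fin.exists_castSucc_eq.2 (hij.trans_le (Fin.le_last j)).ne
  induction j using Fin.lastCases with
  | last => simpa using ha i
  | cast j => simpa using hf (Fin.castSucc_lt_castSucc_iff.1 hij)

theorem sum_chains_succ {M : Type*} [AddCommMonoid M] (r N : ℕ) (F : (Fin (r + 1) → ℕ) → M) :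
    ∑ n ∈ chains (r + 1) N, F n =
      ∑ i ∈ Finset.range N, ∑ n ∈ chains r i, F (Fin.snoc n (i + 1)) := by
  rw [Finset.sum_sigma']
  refine Finset.sum_bij' (fun n _ => ⟨n (Fin.last r) - 1, Fin.init n⟩)
    (fun x _ => Fin.snoc (α := fun _ => ℕ) x.2 (x.1 + 1)) ?_ ?_ ?_ ?_ ?_
  · intro n hn
    obtain ⟨h_mem, h_mono⟩ := mem_chains.1 hn
    have h_last := h_mem (Fin.last r)
    refine Finset.mem_sigma.2 ⟨Finset.mem_range.2 (Nat.sub_one_lt_of_le h_last.1 h_last.2),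
      mem_chains.2 ⟨fun j => ⟨(h_mem _).1, ?_⟩, h_mono.comp Fin.strictMono_castSucc⟩⟩
    exact Nat.le_sub_one_of_lt (h_mono (Fin.castSucc_lt_last j))
  · rintro ⟨i, n⟩ hx
    obtain ⟨hi, hn⟩ := Finset.mem_sigma.1 hx
    obtain ⟨h_mem, h_mono⟩ := mem_chains.1 hn
    have hi : i < N := Finset.mem_range.1 hi
    refine mem_chains.2 ⟨fun j => ?_, strictMono_snoc h_mono fun j => Nat.lt_succ_of_le (h_mem j).2⟩
    induction j using Fin.lastCases with
    | last => simpa using hi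
    | cast j => simpa using ⟨(h_mem j).1, (h_mem j).2.trans hi.le⟩
  · intro n hn
    have h_last := (mem_chains.1 hn).1 (Fin.last r)
    rw [Nat.sub_add_cancel h_last.1, Fin.snoc_init_self]
  · rintro ⟨i, n⟩ _
    simp
  · intro n hn
    have h_last := (mem_chains.1 hn).1 (Fin.last r)
    rw [Nat.sub_add_cancel h_last.1, Fin.snoc_init_self]

/-- The nested sum `∑ f₀(n₁) f₁(n₂) ⋯ f_{r-1}(n_r)` over `0 < n₁ < ⋯ < n_r ≤ N`, which covers
the multiple `T`-sums both with and without signs. -/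
noncomputable def chainSum {R : Type*} [CommSemiring R] (f : ℕ → ℕ → R) (r N : ℕ) : R :=
  ∑ n ∈ chains r N, ∏ j : Fin r, f j (n j)

section ChainSum

variable {R : Type*} [CommSemiring R]

theorem chainSum_zero (f : ℕ → ℕ → R) (N : ℕ) : chainSum f 0 N = 1 := by
  simp [chainSum, chains_zero]

theorem chainSum_succ (f : ℕ → ℕ → R) (r N : ℕ) :
    chainSum f (r + 1) N = ∑ i ∈ Finset.range N, f r (i + 1) * chainSum f r i := by
  simp only [chainSum, sum_chains_succ, Fin.prod_univ_castSucc, Fin.snoc_castSucc, Fin.snoc_last,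
    Fin.val_castSucc, Fin.val_last, Finset.mul_sum, mul_comm]

theorem chainSum_succ_add (f : ℕ → ℕ → R) (r K : ℕ) :
    chainSum f (r + 1) (r + K) =
      ∑ k ∈ Finset.range K, f r (r + k + 1) * chainSum f r (r + k) := by
  rw [chainSum_succ, Finset.sum_range_add, Finset.sum_eq_zero, zero_add]
  intro i hi
  rw [chainSum, chains_eq_empty (Finset.mem_range.1 hi), Finset.sum_empty, mul_zero]

theorem chainSum_congr {f g : ℕ → ℕ → R} {r : ℕ} (h : ∀ j < r, f j = g j) (N : ℕ) :
    chainSum f r N = chainSum g r N :=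
  Finset.sum_congr rfl fun n _ => Finset.prod_congr rfl fun j _ => by rw [h j j.2]

end ChainSum

/-- The terms of the multiple `T`-series with exponents `κ 0, …, κ (r - 1)`, stripped of their
signs and grouped according to `n_r = r + k`. -/
noncomputable def chainCoeff (κ : ℕ → ℕ) : ℕ → ℕ → ℝ
  | 0, k => if k = 0 then 1 else 0
  | r + 1, k => 2 * (∑ i ∈ Finset.range (k + 1), chainCoeff κ r i) / (r + 1 + 2 * k) ^ κ r

theorem sum_range_chainCoeff (κ : ℕ → ℕ) (r K : ℕ) :
    ∑ k ∈ Finset.range (K + 1), chainCoeff κ r k =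
      2 ^ r * chainSum (fun j n => 1 / (2 * (n : ℝ) - (j + 1)) ^ κ j) r (r + K) := by
  induction r generalizing K with
  | zero => simp [chainCoeff, chainSum_zero]
  | succ r ih =>
    rw [show r + 1 + K = r + (K + 1) by ring, chainSum_succ_add, Finset.mul_sum]
    refine Finset.sum_congr rfl fun k _ => ?_
    rw [chainCoeff, ih]
    push_cast
    ring

theorem tBarPartial_eq_sum_chainCoeff (κ : ℕ → ℕ) (r K : ℕ) :
    tBarPartial (fun j : Fin (r + 1) => κ j) (r + K) =
      ∑ k ∈ Finset.range K, (-1) ^ (r + 1 + k) * chainCoeff κ (r + 1) k := by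
  have h_unsigned (N : ℕ) := chainSum_congr (r := r) (N := N)
    (f := fun j n => (if j + 1 = r + 1 then (-1 : ℝ) ^ n else 1) / (2 * (n : ℝ) - (j + 1)) ^ κ j)
    (g := fun j n => 1 / (2 * (n : ℝ) - (j + 1)) ^ κ j)
    fun j hj => by simp [hj.ne]
  calc tBarPartial (fun j : Fin (r + 1) => κ j) (r + K)
      = 2 ^ (r + 1) * chainSum (fun j n => (if j + 1 = r + 1 then (-1 : ℝ) ^ n else 1) /
          (2 * (n : ℝ) - (j + 1)) ^ κ j) (r + 1) (r + K) := rfl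
    _ = ∑ k ∈ Finset.range K, (-1) ^ (r + 1 + k) * chainCoeff κ (r + 1) k := by
        rw [chainSum_succ_add, Finset.mul_sum]
        refine Finset.sum_congr rfl fun k _ => ?_
        rw [h_unsigned, chainCoeff, sum_range_chainCoeff, if_pos rfl]
        push_cast
        ring

theorem chainCoeff_congr {κ κ' : ℕ → ℕ} {r : ℕ} (h : ∀ j < r, κ j = κ' j) (k : ℕ) :
    chainCoeff κ r k = chainCoeff κ' r k := by
  induction r generalizing k with
  | zero => rfl
  | succ r ih =>
    rw [chainCoeff, chainCoeff, h r r.lt_succ_self]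
    simp only [ih fun j hj => h j (hj.trans r.lt_succ_self)]

theorem sum_eq_one_iff_eq_single {ι : Type*} [Fintype ι] [DecidableEq ι] {d : ι → ℕ} :
    ∑ i, d i = 1 ↔ ∃ i, d = Pi.single i 1 := by
  have h := Finsupp.sum_eq_one_iff (Finsupp.equivFunOnFinite.symm d)
  rw [Finsupp.sum_fintype _ _ fun _ => rfl] at h
  refine h.trans (exists_congr fun i => ?_)
  rw [Equiv.symm_apply_eq, Finsupp.equivFunOnFinite_single]

theorem mem_indices_succ_self {r : ℕ} {κ : Fin r → ℕ} :
    κ ∈ indices (r + 1) r ↔ ∃ i : Fin r, κ = 1 + Pi.single i 1 := by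
  rw [indices, Finset.mem_filter, Finset.Nat.mem_antidiagonalTuple]
  constructor
  · rintro ⟨h_sum, h_one⟩
    obtain ⟨d, rfl⟩ : ∃ d, κ = 1 + d := exists_add_of_le (fun j => h_one j)
    rw [show ∑ j, (1 + d) j = r + ∑ j, d j by simp [Finset.sum_add_distrib],
      Nat.add_left_cancel_iff, sum_eq_one_iff_eq_single] at h_sum
    obtain ⟨i, rfl⟩ := h_sum
    exact ⟨i, rfl⟩
  · rintro ⟨i, rfl⟩
    exact ⟨by simp [Finset.sum_add_distrib], fun j => by simp⟩

theorem sum_indices_succ_self {M : Type*} [AddCommMonoid M] (r : ℕ) (F : (Fin r → ℕ) → M) :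
    ∑ κ ∈ indices (r + 1) r, F κ =
      ∑ i ∈ Finset.range r, F fun j => Function.update (1 : ℕ → ℕ) i 2 j := by
  rw [← Fin.sum_univ_eq_sum_range (fun i => F fun j => Function.update (1 : ℕ → ℕ) i 2 j)]
  have h_update (i : Fin r) :
      (fun j : Fin r => Function.update (1 : ℕ → ℕ) i 2 j) = 1 + Pi.single i 1 := by
    funext j
    rcases eq_or_ne j i with rfl | h
    · simp
    · simp [h, Function.update_of_ne (Fin.val_ne_of_ne h)]
  refine (Finset.sum_bij (fun i _ => 1 + Pi.single i 1)
    (fun i _ => mem_indices_succ_self.2 ⟨i, rfl⟩) (fun i _ i' _ h => ?_) (fun κ hκ => ?_)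
    fun i _ => by rw [h_update]).symm
  · by_contra h_ne
    simpa [h_ne] using congrFun h i
  · obtain ⟨i, rfl⟩ := mem_indices_succ_self.1 hκ
    exact ⟨i, Finset.mem_univ i, rfl⟩

/-- The unsigned terms of the series `W(r + 1, r)`, grouped according to `n_r = r + k`: the
exponents are `1` except for a single `2`, whose position is summed over. -/
noncomputable def weightCoeff (r k : ℕ) : ℝ :=
  ∑ i ∈ Finset.range r, chainCoeff (Function.update 1 i 2) r k

theorem chainCoeff_one_succ (r k : ℕ) :
    (r + 1 + 2 * k) * chainCoeff 1 (r + 1) k =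
      2 * ∑ i ∈ Finset.range (k + 1), chainCoeff 1 r i := by
  have h_ne : (r : ℝ) + 1 + 2 * k ≠ 0 := by positivity
  rw [chainCoeff, Pi.one_apply, pow_one, mul_div_cancel₀ _ h_ne]

theorem weightCoeff_succ (r k : ℕ) :
    (r + 1 + 2 * k) * weightCoeff (r + 1) k =
      2 * (∑ i ∈ Finset.range (k + 1), weightCoeff r i) + chainCoeff 1 (r + 1) k := by
  have h_ne : (r : ℝ) + 1 + 2 * k ≠ 0 := by positivity
  have h_old : ∀ i ∈ Finset.range r,
      (r + 1 + 2 * k) * chainCoeff (Function.update 1 i 2) (r + 1) k =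
        2 * ∑ l ∈ Finset.range (k + 1), chainCoeff (Function.update 1 i 2) r l := by
    intro i hi
    rw [chainCoeff, Function.update_of_ne (Finset.mem_range.1 hi).ne', Pi.one_apply, pow_one,
      mul_div_cancel₀ _ h_ne]
  have h_new : (r + 1 + 2 * k) * chainCoeff (Function.update 1 r 2) (r + 1) k =
      chainCoeff 1 (r + 1) k := by
    have h_congr (l : ℕ) : chainCoeff (Function.update 1 r 2) r l = chainCoeff 1 r l :=
      chainCoeff_congr (fun j hj => by rw [Function.update_of_ne hj.ne]) l
    simp only [chainCoeff, Function.update_self, h_congr, Pi.one_apply]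
    field_simp
  rw [weightCoeff, Finset.sum_range_succ, mul_add, h_new, Finset.mul_sum,
    Finset.sum_congr rfl h_old, ← Finset.mul_sum, Finset.sum_comm]
  rfl

end Chains

section Convergence

theorem summable_abs_sub_of_antitone {a v : ℕ → ℝ} (ha : ∀ k, 0 ≤ a k) (hv : ∀ k, 0 ≤ v k)
    (hv_anti : Antitone v) (h : Summable fun k => a k * v k) :
    Summable fun k => |(∑ i ∈ Finset.range (k + 2), a i) * v (k + 1) -
      (∑ i ∈ Finset.range (k + 1), a i) * v k| := by
  set S : ℕ → ℝ := fun k => ∑ i ∈ Finset.range (k + 1), a i with hS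
  have hS_nonneg (k : ℕ) : 0 ≤ S k := Finset.sum_nonneg fun i _ => ha i
  have hS_succ (k : ℕ) : S (k + 1) = S k + a (k + 1) := Finset.sum_range_succ a (k + 1)
  have h_decrement_nonneg (k : ℕ) : 0 ≤ S k * (v k - v (k + 1)) :=
    mul_nonneg (hS_nonneg k) (sub_nonneg.2 (hv_anti k.le_succ))
  have h_abel (n : ℕ) : ∑ k ∈ Finset.range n, S k * (v k - v (k + 1)) =
      (∑ k ∈ Finset.range (n + 1), a k * v k) - S n * v n := by
    induction n with
    | zero => simp [hS]
    | succ n ih =>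
      rw [Finset.sum_range_succ, ih, Finset.sum_range_succ _ (n + 1), hS_succ]
      ring
  have h_decrement : Summable fun k => S k * (v k - v (k + 1)) := by
    refine summable_of_sum_range_le (c := ∑' k, a k * v k) h_decrement_nonneg fun n => ?_
    calc ∑ k ∈ Finset.range n, S k * (v k - v (k + 1))
        ≤ ∑ k ∈ Finset.range (n + 1), a k * v k := by
          rw [h_abel]
          exact sub_le_self _ (mul_nonneg (hS_nonneg n) (hv n))
      _ ≤ ∑' k, a k * v k := h.sum_le_tsum _ fun k _ => mul_nonneg (ha k) (hv k)
  have h_increment : Summable fun k => a (k + 1) * v (k + 1) := (summable_nat_add_iff 1).2 h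
  refine .of_nonneg_of_le (fun k => abs_nonneg _) (fun k => ?_) (h_increment.add h_decrement)
  calc |S (k + 1) * v (k + 1) - S k * v k|
      = |a (k + 1) * v (k + 1) - S k * (v k - v (k + 1))| := by rw [hS_succ]; ring_nf
    _ ≤ |a (k + 1) * v (k + 1)| + |S k * (v k - v (k + 1))| := abs_sub _ _
    _ = a (k + 1) * v (k + 1) + S k * (v k - v (k + 1)) := by
        rw [abs_of_nonneg (mul_nonneg (ha _) (hv _)), abs_of_nonneg (h_decrement_nonneg k)]

theorem exists_tendsto_alternating_sum {E : Type*} [NormedAddCommGroup E] [NormedSpace ℝ E]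
    [CompleteSpace E] {c : ℕ → E} (h_zero : Tendsto c atTop (𝓝 0))
    (h_var : Summable fun k => ‖c (k + 1) - c k‖) :
    ∃ l, Tendsto (fun K => ∑ k ∈ Finset.range K, (-1 : ℝ) ^ k • c k) atTop (𝓝 l) := by
  have h_parts (K : ℕ) : ∑ k ∈ Finset.range K, (-1 : ℝ) ^ k • c k = (2⁻¹ : ℝ) •
      (c 0 - (-1 : ℝ) ^ K • c K - ∑ k ∈ Finset.range K, (-1 : ℝ) ^ k • (c (k + 1) - c k)) := by
    induction K with
    | zero => simp
    | succ K ih =>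
      rw [Finset.sum_range_succ, ih, Finset.sum_range_succ]
      module
  have h_norm (k : ℕ) (x : E) : ‖(-1 : ℝ) ^ k • x‖ = ‖x‖ := by simp [norm_smul]
  have h_boundary : Tendsto (fun K => (-1 : ℝ) ^ K • c K) atTop (𝓝 0) := by
    rw [tendsto_zero_iff_norm_tendsto_zero] at h_zero ⊢
    simpa only [h_norm] using h_zero
  have h_sum : Summable fun k => (-1 : ℝ) ^ k • (c (k + 1) - c k) :=
    .of_norm (by simpa only [h_norm] using h_var)
  simp only [h_parts]
  exact ⟨_, ((h_boundary.const_sub (c 0)).sub h_sum.hasSum.tendsto_sum_nat).const_smul _⟩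

theorem sum_one_div_sqrt_le (n : ℕ) :
    ∑ i ∈ Finset.range n, 1 / √((i : ℝ) + 1) ≤ 2 * √(n : ℝ) := by
  induction n with
  | zero => simp
  | succ n ih =>
    have h_step : 1 / √((n : ℝ) + 1) ≤ 2 * √((n : ℝ) + 1) - 2 * √(n : ℝ) := by
      have hx := Real.sq_sqrt (Nat.cast_nonneg n : (0 : ℝ) ≤ n)
      have hy := Real.sq_sqrt (by positivity : (0 : ℝ) ≤ (n : ℝ) + 1)
      rw [div_le_iff₀ (by positivity)]
      nlinarith [sq_nonneg (√((n : ℝ) + 1) - √(n : ℝ))]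
    rw [Finset.sum_range_succ, Nat.cast_succ]
    linarith

theorem chainCoeff_nonneg (κ : ℕ → ℕ) (r k : ℕ) : 0 ≤ chainCoeff κ r k := by
  induction r generalizing k with
  | zero => rw [chainCoeff]; split_ifs <;> norm_num
  | succ r ih =>
    have h_sum := Finset.sum_nonneg fun i (_ : i ∈ Finset.range (k + 1)) => ih i
    rw [chainCoeff]
    positivity

theorem add_one_le_pow {r k e : ℕ} (he : 1 ≤ e) : (k : ℝ) + 1 ≤ (r + 1 + 2 * k) ^ e := by
  have h_base : k + 1 ≤ r + 1 + 2 * k := by omega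
  exact_mod_cast h_base.trans (le_self_pow₀ (by omega) (by omega))

theorem chainCoeff_le {κ : ℕ → ℕ} (hκ : ∀ j, 1 ≤ κ j) (r k : ℕ) :
    chainCoeff κ r k ≤ 4 ^ r / √((k : ℝ) + 1) := by
  induction r generalizing k with
  | zero =>
    rw [chainCoeff]
    split_ifs with h
    · simp [h]
    · positivity
  | succ r ih =>
    have h_sum : ∑ i ∈ Finset.range (k + 1), chainCoeff κ r i ≤ 4 ^ r * (2 * √((k : ℝ) + 1)) := by
      calc ∑ i ∈ Finset.range (k + 1), chainCoeff κ r i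
          ≤ ∑ i ∈ Finset.range (k + 1), 4 ^ r * (1 / √((i : ℝ) + 1)) :=
            Finset.sum_le_sum fun i _ => (ih i).trans_eq (by ring)
        _ ≤ 4 ^ r * (2 * √((k : ℝ) + 1)) := by
            rw [← Finset.mul_sum]
            gcongr
            exact_mod_cast sum_one_div_sqrt_le (k + 1)
    have h_sqrt := Real.mul_self_sqrt (by positivity : (0 : ℝ) ≤ (k : ℝ) + 1)
    rw [chainCoeff]
    calc 2 * (∑ i ∈ Finset.range (k + 1), chainCoeff κ r i) / ((r : ℝ) + 1 + 2 * k) ^ κ r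
        ≤ 2 * (4 ^ r * (2 * √((k : ℝ) + 1))) / (k + 1) := by
          gcongr
          exact add_one_le_pow (hκ r)
      _ = 4 ^ (r + 1) / √((k : ℝ) + 1) := by
          rw [div_eq_div_iff (by positivity) (by positivity)]
          linear_combination 4 * 4 ^ r * h_sqrt

theorem tendsto_chainCoeff {κ : ℕ → ℕ} (hκ : ∀ j, 1 ≤ κ j) (r : ℕ) :
    Tendsto (chainCoeff κ r) atTop (𝓝 0) := by
  refine squeeze_zero (chainCoeff_nonneg κ r) (chainCoeff_le hκ r)
    (Tendsto.div_atTop tendsto_const_nhds ?_)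
  exact Real.tendsto_sqrt_atTop.comp
    (tendsto_atTop_add_const_right _ 1 tendsto_natCast_atTop_atTop)

theorem summable_one_div_mul_sqrt :
    Summable fun k : ℕ => 1 / (((k : ℝ) + 1) * √((k : ℝ) + 1)) := by
  refine ((summable_nat_add_iff 1).2
    (Real.summable_one_div_nat_rpow.2 (by norm_num : (1 : ℝ) < 3 / 2))).congr fun k => ?_
  have hk : (0 : ℝ) < (k : ℝ) + 1 := by positivity
  rw [Nat.cast_succ, show (3 / 2 : ℝ) = 1 + 1 / 2 by norm_num, Real.rpow_add hk, Real.rpow_one,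
    Real.sqrt_eq_rpow]

theorem summable_abs_chainCoeff_sub {κ : ℕ → ℕ} (hκ : ∀ j, 1 ≤ κ j) (r : ℕ) :
    Summable fun k => |chainCoeff κ (r + 1) (k + 1) - chainCoeff κ (r + 1) k| := by
  let v : ℕ → ℝ := fun k => 2 / (r + 1 + 2 * k) ^ κ r
  have hv_anti : Antitone v := by
    intro k l hkl
    dsimp only [v]
    gcongr
  have h_summable : Summable fun k => chainCoeff κ r k * v k := by
    refine .of_nonneg_of_le (fun k => mul_nonneg (chainCoeff_nonneg κ r k) (by positivity))
      (fun k => ?_) (summable_one_div_mul_sqrt.mul_left (2 * 4 ^ r))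
    calc chainCoeff κ r k * v k
        ≤ 4 ^ r / √((k : ℝ) + 1) * (2 / (k + 1)) := by
          dsimp only [v]
          gcongr
          · exact chainCoeff_le hκ r k
          · exact add_one_le_pow (hκ r)
      _ = 2 * 4 ^ r * (1 / (((k : ℝ) + 1) * √((k : ℝ) + 1))) := by field_simp
  refine (summable_abs_sub_of_antitone (chainCoeff_nonneg κ r) (fun k => by positivity) hv_anti
    h_summable).congr fun k => ?_
  simp only [v, chainCoeff]
  ring_nf

theorem exists_tendsto_tBarPartial {r : ℕ} {κ : ℕ → ℕ} (hκ : ∀ j, 1 ≤ κ j) :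
    ∃ l, Tendsto (tBarPartial fun j : Fin (r + 1) => κ j) atTop (𝓝 l) := by
  obtain ⟨l, hl⟩ := exists_tendsto_alternating_sum (tendsto_chainCoeff hκ (r + 1))
    (summable_abs_chainCoeff_sub hκ r)
  refine ⟨(-1) ^ (r + 1) * l, (tendsto_add_atTop_iff_nat r).1 ?_⟩
  refine (hl.const_mul ((-1) ^ (r + 1))).congr fun K => ?_
  rw [add_comm K r, tBarPartial_eq_sum_chainCoeff, Finset.mul_sum]
  simp only [smul_eq_mul, pow_add, mul_assoc]

theorem tendsto_tBarPartial {k r : ℕ} {κ : Fin (r + 1) → ℕ} (hκ : κ ∈ indices k (r + 1)) :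
    Tendsto (tBarPartial κ) atTop (𝓝 (tBar κ)) := by
  have hκ_one : ∀ j, 1 ≤ κ j := (Finset.mem_filter.1 hκ).2
  obtain ⟨κ', hκ', rfl⟩ : ∃ κ' : ℕ → ℕ, (∀ j, 1 ≤ κ' j) ∧ κ = fun j : Fin (r + 1) => κ' j := by
    refine ⟨fun n => if h : n < r + 1 then κ ⟨n, h⟩ else 1, fun j => ?_, funext fun j => ?_⟩
    · dsimp only
      split_ifs
      exacts [hκ_one _, le_rfl]
    · dsimp only
      rw [dif_pos j.2]
  exact tendsto_nhds_limUnder (exists_tendsto_tBarPartial hκ')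

theorem tendsto_alternating_weightCoeff (r : ℕ) :
    Tendsto (fun K => ∑ k ∈ Finset.range K, (-1) ^ (r + k) * weightCoeff r k) atTop
      (𝓝 (W (r + 1) r)) := by
  cases r with
  | zero => simp [weightCoeff, W, sum_indices_succ_self]
  | succ r =>
    have h : Tendsto (fun N => ∑ κ ∈ indices (r + 2) (r + 1), tBarPartial κ N) atTop
        (𝓝 (W (r + 2) (r + 1))) := tendsto_finsetSum _ fun κ hκ => tendsto_tBarPartial hκ
    refine ((tendsto_add_atTop_iff_nat r).2 h).congr fun K => ?_
    rw [sum_indices_succ_self (r + 1) fun κ => tBarPartial κ (K + r), add_comm K r]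
    simp only [tBarPartial_eq_sum_chainCoeff, weightCoeff, Finset.mul_sum]
    exact Finset.sum_comm

end Convergence

section AlternatingSeries

/-- The power series `∑ (-1)^(r+k) c_k t^(r+2k)`. With `c` the coefficients of an alternating
multiple `T`-value of depth `r`, its Abel limit at `t = 1` is that value. -/
noncomputable def altSeries (c : ℕ → ℝ) (r : ℕ) (t : ℝ) : ℝ :=
  (-t) ^ r * ∑' k, c k * (-t ^ 2) ^ k

theorem abs_neg_sq_lt_one {t : ℝ} (ht : |t| < 1) : |-t ^ 2| < 1 := by
  rwa [abs_neg, abs_pow, sq_lt_one_iff₀ (abs_nonneg t)]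

theorem summable_norm_mul_pow {c : ℕ → ℝ} {C x : ℝ} (hc : ∀ k, |c k| ≤ C) (hx : |x| < 1) :
    Summable fun k => ‖c k * x ^ k‖ := by
  refine .of_nonneg_of_le (fun k => norm_nonneg _) (fun k => ?_)
    ((summable_geometric_of_lt_one (abs_nonneg x) hx).mul_left C)
  rw [norm_mul, norm_pow, Real.norm_eq_abs, Real.norm_eq_abs]
  gcongr
  exact hc k

theorem hasSum_sum_range_mul_pow {b : ℕ → ℝ} {x : ℝ} (hb : Summable fun k => ‖b k * x ^ k‖)
    (hx : |x| < 1) :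
    HasSum (fun k => (∑ i ∈ Finset.range (k + 1), b i) * x ^ k)
      ((∑' k, b k * x ^ k) / (1 - x)) := by
  have h_geom : Summable fun k => ‖x ^ k‖ := by
    simpa only [norm_pow] using summable_geometric_of_lt_one (norm_nonneg x) hx
  have h := hasSum_sum_range_mul_of_summable_norm hb h_geom
  rw [tsum_geometric_of_norm_lt_one hx, ← div_eq_mul_inv] at h
  refine h.congr_fun fun k => ?_
  rw [Finset.sum_mul]
  refine Finset.sum_congr rfl fun i hi => ?_
  rw [mul_assoc, ← pow_add, Nat.add_sub_cancel' (Finset.mem_range_succ_iff.1 hi)]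

theorem hasDerivAt_altSeries_term (c : ℝ) (r k : ℕ) (y : ℝ) :
    HasDerivAt (fun y : ℝ => (-y) ^ (r + 1) * (c * (-y ^ 2) ^ k))
      (-(-y) ^ r * ((r + 1 + 2 * k) * c * (-y ^ 2) ^ k)) y := by
  have h_fun : (fun y : ℝ => (-y) ^ (r + 1) * (c * (-y ^ 2) ^ k)) =
      fun y => (-1) ^ (r + 1 + k) * c * y ^ (r + 2 * k + 1) := by
    funext y
    rw [neg_pow y, neg_pow (y ^ 2)]
    ring
  rw [h_fun]
  refine ((hasDerivAt_pow (r + 2 * k + 1) y).const_mul _).congr_deriv ?_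
  rw [neg_pow y, neg_pow (y ^ 2), Nat.add_sub_cancel]
  push_cast
  ring

theorem norm_deriv_altSeries_term_le {c C ρ y : ℝ} (hc : |c| ≤ C) (hy : |y| ≤ ρ) (hρ : ρ ≤ 1)
    (r k : ℕ) :
    ‖-(-y) ^ r * ((r + 1 + 2 * k) * c * (-y ^ 2) ^ k)‖ ≤ (r + 1 + 2 * k) * C * ρ ^ k := by
  have h_head : |-(-y) ^ r| ≤ 1 := by
    rw [abs_neg, abs_pow, abs_neg]
    exact pow_le_one₀ (abs_nonneg y) (hy.trans hρ)
  have h_tail : |(-y ^ 2) ^ k| ≤ ρ ^ k := by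
    rw [abs_pow, abs_neg, abs_pow]
    gcongr
    exact (pow_le_of_le_one (abs_nonneg y) (hy.trans hρ) two_ne_zero).trans hy
  calc ‖-(-y) ^ r * ((r + 1 + 2 * k) * c * (-y ^ 2) ^ k)‖
      = |-(-y) ^ r| * ((r + 1 + 2 * k) * |c| * |(-y ^ 2) ^ k|) := by
        rw [Real.norm_eq_abs, abs_mul, abs_mul, abs_mul,
          abs_of_nonneg (by positivity : (0 : ℝ) ≤ r + 1 + 2 * k)]
    _ ≤ 1 * ((r + 1 + 2 * k) * C * ρ ^ k) := by
        gcongr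
        exact mul_nonneg (by positivity) ((abs_nonneg c).trans hc)
    _ = (r + 1 + 2 * k) * C * ρ ^ k := one_mul _

theorem hasDerivAt_altSeries {c : ℕ → ℝ} {C s t : ℝ} {r : ℕ} (hc : ∀ k, |c k| ≤ C) (ht : |t| < 1)
    (hs : HasSum (fun k => (r + 1 + 2 * k) * c k * (-t ^ 2) ^ k) s) :
    HasDerivAt (altSeries c (r + 1)) (-(-t) ^ r * s) t := by
  obtain ⟨ρ, htρ, hρ_lt⟩ := exists_between ht
  have hρ_nonneg : 0 ≤ ρ := (abs_nonneg t).trans htρ.le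
  have h_bound : Summable fun k : ℕ => ((r : ℝ) + 1 + 2 * k) * C * ρ ^ k := by
    have h_linear := summable_pow_mul_geometric_of_norm_lt_one 1 (r := ρ)
      (by rwa [Real.norm_of_nonneg hρ_nonneg])
    refine (((summable_geometric_of_lt_one hρ_nonneg hρ_lt).mul_left ((r + 1) * C)).add
      (h_linear.mul_left (2 * C))).congr fun k => ?_
    ring
  have h_deriv := hasDerivAt_tsum_of_isPreconnected h_bound isOpen_Ioo isPreconnected_Ioo
    (fun k y _ => hasDerivAt_altSeries_term (c k) r k y)
    (fun k y (hy : y ∈ Set.Ioo (-ρ) ρ) => ?_) (abs_lt.1 htρ)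
    ((summable_norm_mul_pow hc (abs_neg_sq_lt_one ht)).of_norm.mul_left _) (abs_lt.1 htρ)
  · rw [tsum_mul_left, hs.tsum_eq] at h_deriv
    exact h_deriv.congr_of_eventuallyEq (.of_forall fun y => tsum_mul_left.symm)
  · exact norm_deriv_altSeries_term_le (hc k) (abs_lt.2 hy).le hρ_lt.le r k

theorem tendsto_altSeries {c : ℕ → ℝ} {r : ℕ} {l : ℝ}
    (h : Tendsto (fun K => ∑ k ∈ Finset.range K, (-1) ^ (r + k) * c k) atTop (𝓝 l)) :
    Tendsto (altSeries c r) (𝓝[<] 1) (𝓝 l) := by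
  have h_sq : Tendsto (fun t : ℝ => t ^ 2) (𝓝[<] 1) (𝓝[<] 1) := by
    refine tendsto_nhdsWithin_iff.2 ⟨?_, ?_⟩
    · exact ((continuous_pow 2).tendsto' 1 1 (one_pow 2)).mono_left nhdsWithin_le_nhds
    · filter_upwards [Ioo_mem_nhdsLT (zero_lt_one (α := ℝ))] with t ht
      exact pow_lt_one₀ ht.1.le ht.2 two_ne_zero
  have h_pow : Tendsto (fun t : ℝ => t ^ r) (𝓝[<] 1) (𝓝 1) :=
    ((continuous_pow r).tendsto' 1 1 (one_pow r)).mono_left nhdsWithin_le_nhds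
  have h_abel := h_pow.mul ((Real.tendsto_tsum_powerSeries_nhdsWithin_lt h).comp h_sq)
  rw [one_mul] at h_abel
  refine h_abel.congr fun t => ?_
  rw [altSeries, Function.comp_apply, ← tsum_mul_left, ← tsum_mul_left]
  refine tsum_congr fun k => ?_
  rw [neg_pow t, neg_pow (t ^ 2)]
  ring

theorem altSeries_succ_zero (c : ℕ → ℝ) (r : ℕ) : altSeries c (r + 1) 0 = 0 := by
  simp [altSeries]

theorem abs_chainCoeff_le {κ : ℕ → ℕ} (hκ : ∀ j, 1 ≤ κ j) (r k : ℕ) :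
    |chainCoeff κ r k| ≤ 4 ^ r := by
  rw [abs_of_nonneg (chainCoeff_nonneg κ r k)]
  refine (chainCoeff_le hκ r k).trans (div_le_self (by positivity) ?_)
  rw [Real.one_le_sqrt]
  linarith [(Nat.cast_nonneg k : (0 : ℝ) ≤ k)]

theorem abs_chainCoeff_one_le (r k : ℕ) : |chainCoeff 1 r k| ≤ 4 ^ r :=
  abs_chainCoeff_le (fun _ => le_rfl) r k

theorem abs_weightCoeff_le (r k : ℕ) : |weightCoeff r k| ≤ r * 4 ^ r :=
  calc |weightCoeff r k|
      ≤ ∑ i ∈ Finset.range r, |chainCoeff (Function.update 1 i 2) r k| :=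
        Finset.abs_sum_le_sum_abs _ _
    _ ≤ ∑ _i ∈ Finset.range r, (4 : ℝ) ^ r := by
        refine Finset.sum_le_sum fun i _ => abs_chainCoeff_le (fun j => ?_) r k
        by_cases h : j = i <;> simp [h]
    _ = r * 4 ^ r := by simp

theorem hasDerivAt_altSeries_chainCoeff {t : ℝ} (ht : |t| < 1) (r : ℕ) :
    HasDerivAt (altSeries (chainCoeff 1 (r + 1)) (r + 1))
      (-2 * altSeries (chainCoeff 1 r) r t / (1 + t ^ 2)) t := by
  have hx := abs_neg_sq_lt_one ht
  have h_sum := (hasSum_sum_range_mul_pow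
    (summable_norm_mul_pow (abs_chainCoeff_one_le r) hx) hx).mul_left 2
  refine (hasDerivAt_altSeries (abs_chainCoeff_one_le (r + 1)) ht
    (h_sum.congr_fun fun k => ?_)).congr_deriv ?_
  · rw [chainCoeff_one_succ]
    ring
  · rw [altSeries]
    ring

theorem hasDerivAt_altSeries_weightCoeff {t : ℝ} (ht : |t| < 1) (ht₀ : t ≠ 0) (r : ℕ) :
    HasDerivAt (altSeries (weightCoeff (r + 1)) (r + 1))
      (-2 * altSeries (weightCoeff r) r t / (1 + t ^ 2) +
        altSeries (chainCoeff 1 (r + 1)) (r + 1) t / t) t := by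
  have hx := abs_neg_sq_lt_one ht
  have h_weight := (hasSum_sum_range_mul_pow
    (summable_norm_mul_pow (abs_weightCoeff_le r) hx) hx).mul_left 2
  have h_chain := (summable_norm_mul_pow (abs_chainCoeff_one_le (r + 1)) hx).of_norm.hasSum
  refine (hasDerivAt_altSeries (abs_weightCoeff_le (r + 1)) ht
    ((h_weight.add h_chain).congr_fun fun k => ?_)).congr_deriv ?_
  · rw [weightCoeff_succ]
    ring
  · rw [altSeries, altSeries, pow_succ (-t), sub_neg_eq_add]
    field_simp
    ring

theorem altSeries_chainCoeff {t : ℝ} (ht : |t| < 1) (r : ℕ) :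
    altSeries (chainCoeff 1 r) r t = (-2 * Real.arctan t) ^ r / r.factorial := by
  induction r generalizing t with
  | zero =>
    rw [altSeries, tsum_eq_single 0]
    · simp [chainCoeff]
    · intro k hk
      simp [chainCoeff, hk]
  | succ r ih =>
    have h_left {y : ℝ} (hy : y ∈ Set.Ioo (-1 : ℝ) 1) :=
      hasDerivAt_altSeries_chainCoeff (abs_lt.2 hy) r
    have h_right (y : ℝ) : HasDerivAt
        (fun y => (-2 * Real.arctan y) ^ (r + 1) / ((r + 1).factorial : ℝ))
        (-2 * ((-2 * Real.arctan y) ^ r / r.factorial) / (1 + y ^ 2)) y := by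
      refine ((((Real.hasDerivAt_arctan y).const_mul (-2)).pow (r + 1)).div_const
        ((r + 1).factorial : ℝ)).congr_deriv ?_
      rw [Nat.factorial_succ]
      push_cast
      field_simp
    refine isOpen_Ioo.eqOn_of_deriv_eq isPreconnected_Ioo
      (fun y hy => (h_left hy).differentiableAt.differentiableWithinAt)
      (fun y _ => (h_right y).differentiableAt.differentiableWithinAt) (fun y hy => ?_)
      (x := 0) (by norm_num) (by simp [altSeries_succ_zero]) (abs_lt.1 ht)
    rw [(h_left hy).deriv, (h_right y).deriv, ih (abs_lt.2 hy)]

end AlternatingSeries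

section HalfAngle

/-- The power series with Abel limit `W(r+1, r)` at `t = 1`, in the half-angle variable
`t = tan (θ/2)`, so that `W(r+1, r)` is its limit at `θ = π/2`. -/
noncomputable def halfAngleSeries (r : ℕ) (θ : ℝ) : ℝ :=
  altSeries (weightCoeff r) r (Real.tan (θ / 2))

theorem halfAngleSeries_zero : halfAngleSeries 0 = 0 := by
  funext θ
  simp [halfAngleSeries, altSeries, weightCoeff]

theorem tan_half_mem_Ioo {θ : ℝ} (hθ : θ ∈ Set.Ioo 0 (π / 2)) :
    Real.tan (θ / 2) ∈ Set.Ioo (0 : ℝ) 1 := by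
  obtain ⟨h_pos, h_lt⟩ := hθ
  refine ⟨Real.tan_pos_of_pos_of_lt_pi_div_two (by linarith) (by linarith), ?_⟩
  rw [← Real.tan_pi_div_four]
  exact Real.tan_lt_tan_of_lt_of_lt_pi_div_two (by linarith) (by linarith) (by linarith)

theorem hasDerivAt_halfAngleSeries_succ {θ : ℝ} (hθ : θ ∈ Set.Ioo 0 (π / 2)) (r : ℕ) :
    HasDerivAt (halfAngleSeries (r + 1))
      ((-θ) ^ (r + 1) / (r + 1).factorial / Real.sin θ - halfAngleSeries r θ) θ := by
  have ht := tan_half_mem_Ioo hθ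
  have ht_abs : |Real.tan (θ / 2)| < 1 := by rw [abs_of_pos ht.1]; exact ht.2
  obtain ⟨h_pos, h_lt⟩ := hθ
  have h_cos : Real.cos (θ / 2) ≠ 0 :=
    (Real.cos_pos_of_mem_Ioo ⟨by linarith, by linarith⟩).ne'
  have h_sin : Real.sin (θ / 2) ≠ 0 :=
    (Real.sin_pos_of_pos_of_lt_pi (by linarith) (by linarith)).ne'
  have h_tan : HasDerivAt (fun x : ℝ => Real.tan (x / 2))
      (1 / Real.cos (θ / 2) ^ 2 * (1 / 2)) θ :=
    HasDerivAt.comp (h₂ := Real.tan) θ (Real.hasDerivAt_tan h_cos) ((hasDerivAt_id θ).div_const 2)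
  have h_arctan : -2 * Real.arctan (Real.tan (θ / 2)) = -θ := by
    rw [Real.arctan_tan (by linarith) (by linarith)]
    ring
  have h_sec : 1 + Real.tan (θ / 2) ^ 2 = 1 / Real.cos (θ / 2) ^ 2 := by
    rw [one_div, ← Real.inv_one_add_tan_sq h_cos, inv_inv]
  have h_double : Real.sin θ = 2 * Real.sin (θ / 2) * Real.cos (θ / 2) := by
    rw [← Real.sin_two_mul, mul_div_cancel₀ θ two_ne_zero]
  refine ((hasDerivAt_altSeries_weightCoeff ht_abs ht.1.ne' r).comp θ h_tan).congr_deriv ?_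
  rw [halfAngleSeries, altSeries_chainCoeff ht_abs, h_arctan, h_sec, h_double]
  generalize altSeries (weightCoeff r) r (Real.tan (θ / 2)) = w
  rw [Real.tan_eq_sin_div_cos]
  field_simp
  ring

theorem tendsto_tan_half :
    Tendsto (fun θ : ℝ => Real.tan (θ / 2)) (𝓝[<] (π / 2)) (𝓝[<] 1) := by
  have h_quarter : π / 2 / 2 = π / 4 := by ring
  refine tendsto_nhdsWithin_iff.2 ⟨?_, ?_⟩
  · have h_cont : ContinuousAt (fun θ : ℝ => Real.tan (θ / 2)) (π / 2) := by
      refine ContinuousAt.comp (g := Real.tan) (Real.continuousAt_tan.2 ?_) (by fun_prop)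
      rw [h_quarter, Real.cos_pi_div_four]
      positivity
    have h_lim := h_cont.tendsto
    rw [h_quarter, Real.tan_pi_div_four] at h_lim
    exact h_lim.mono_left nhdsWithin_le_nhds
  · filter_upwards [Ioo_mem_nhdsLT Real.pi_div_two_pos] with θ hθ
    exact (tan_half_mem_Ioo hθ).2

theorem tendsto_halfAngleSeries_pi_div_two (r : ℕ) :
    Tendsto (halfAngleSeries r) (𝓝[<] (π / 2)) (𝓝 (W (r + 1) r)) :=
  (tendsto_altSeries (tendsto_alternating_weightCoeff r)).comp tendsto_tan_half

theorem tendsto_halfAngleSeries_zero (r : ℕ) : Tendsto (halfAngleSeries r) (𝓝 0) (𝓝 0) := by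
  cases r with
  | zero =>
    rw [halfAngleSeries_zero]
    exact tendsto_const_nhds
  | succ r =>
    have h_tan : Tendsto (fun θ : ℝ => Real.tan (θ / 2)) (𝓝 0) (𝓝 0) := by
      have h : ContinuousAt (fun θ : ℝ => Real.tan (θ / 2)) 0 :=
        ContinuousAt.comp (g := Real.tan) (Real.continuousAt_tan.2 (by simp)) (by fun_prop)
      simpa only [zero_div, Real.tan_zero] using h.tendsto
    have h_series : Tendsto (altSeries (weightCoeff (r + 1)) (r + 1)) (𝓝 0) (𝓝 0) := by
      have h_sum : Summable fun k : ℕ =>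
          ((r : ℝ) + 1 + 2 * k) * weightCoeff (r + 1) k * (-0 ^ 2) ^ k :=
        summable_of_ne_finset_zero (s := {0}) fun k hk => by
          simp [Finset.notMem_singleton.1 hk]
      have h := (hasDerivAt_altSeries (abs_weightCoeff_le (r + 1)) (by simp)
        h_sum.hasSum).continuousAt.tendsto
      rwa [altSeries_succ_zero] at h
    exact h_series.comp h_tan

end HalfAngle

section Primitive

theorem hasDerivAt_pow_div_factorial (b x : ℝ) (n : ℕ) :
    HasDerivAt (fun y : ℝ => (y - b) ^ (n + 1) / ((n + 1).factorial : ℝ))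
      ((x - b) ^ n / n.factorial) x := by
  refine ((((hasDerivAt_id' x).sub_const b).fun_pow (n + 1)).div_const _).congr_deriv ?_
  rw [Nat.factorial_succ, Nat.add_sub_cancel]
  push_cast
  field_simp

theorem sum_antidiagonal_pow_div_factorial (x y : ℝ) (n : ℕ) :
    ∑ p ∈ antidiagonal n, x ^ p.1 / p.1.factorial * (y ^ p.2 / p.2.factorial) =
      (x + y) ^ n / n.factorial := by
  rw [(Commute.all x y).add_pow', Finset.sum_div]
  refine Finset.sum_congr rfl fun p hp => ?_
  rw [← Finset.HasAntidiagonal.mem_antidiagonal.1 hp, nsmul_eq_mul, Nat.cast_add_choose]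
  field_simp

/-- Variation of parameters: the couplings `-Φ_i` in the derivatives cancel against the derivatives
of the divided powers. -/
theorem hasDerivAt_sum_antidiagonal_mul_pow {Φ : ℕ → ℝ → ℝ} {u : ℕ → ℝ} {x : ℝ}
    (h_zero : HasDerivAt (Φ 0) (u 0) x)
    (h_succ : ∀ i, HasDerivAt (Φ (i + 1)) (u (i + 1) - Φ i x) x) (b : ℝ) (n : ℕ) :
    HasDerivAt (fun y => ∑ p ∈ antidiagonal n, Φ p.1 y * ((y - b) ^ p.2 / p.2.factorial))
      (∑ p ∈ antidiagonal n, u p.1 * ((x - b) ^ p.2 / p.2.factorial)) x := by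
  have h_deriv (i : ℕ) : HasDerivAt (Φ i) (deriv (Φ i) x) x := by
    cases i with
    | zero => exact h_zero.differentiableAt.hasDerivAt
    | succ i => exact (h_succ i).differentiableAt.hasDerivAt
  cases n with
  | zero => simpa using h_zero
  | succ n =>
    have h_sum := ((h_deriv (n + 1)).mul_const ((x - b) ^ 0 / (Nat.factorial 0 : ℝ))).fun_add
      (.fun_sum (u := antidiagonal n) fun p _ =>
        (h_deriv p.1).mul (hasDerivAt_pow_div_factorial b x p.2))
    refine (h_sum.congr_of_eventuallyEq
      (.of_forall fun y => Finset.Nat.sum_antidiagonal_succ')).congr_deriv ?_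
    calc _ = ∑ p ∈ antidiagonal (n + 1),
          deriv (Φ p.1) x * ((x - b) ^ p.2 / p.2.factorial) +
          ∑ p ∈ antidiagonal n,
            Φ p.1 x * ((x - b) ^ p.2 / p.2.factorial) := by
          rw [Finset.Nat.sum_antidiagonal_succ', Finset.sum_add_distrib]
          simp only [pow_zero, Nat.factorial_zero, Nat.cast_one, div_one, mul_one]
          ring
      _ = _ := by
          simp only [Finset.Nat.sum_antidiagonal_succ, h_zero.deriv, (h_succ _).deriv, sub_mul,
            Finset.sum_sub_distrib]
          ring

/-- The combination of the half-angle series of depth up to `n` whose derivative is elementary. -/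
noncomputable def primitive (n : ℕ) (θ : ℝ) : ℝ :=
  ∑ p ∈ antidiagonal n,
    halfAngleSeries p.1 θ * ((θ - π / 2) ^ p.2 / p.2.factorial)

theorem hasDerivAt_primitive {θ : ℝ} (hθ : θ ∈ Set.Ioo 0 (π / 2)) (n : ℕ) :
    HasDerivAt (primitive n)
      (((-(π / 2)) ^ n - (θ - π / 2) ^ n) / n.factorial / Real.sin θ) θ := by
  -- The `0 ^ i / i!` removes the term `i = 0`, so that both parts are divided-power expansions.
  let u (i : ℕ) : ℝ := ((-θ) ^ i / i.factorial - 0 ^ i / i.factorial) / Real.sin θ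
  have h_zero : HasDerivAt (halfAngleSeries 0) (u 0) θ := by
    rw [halfAngleSeries_zero]
    simp [u]
  have h_succ (i : ℕ) :
      HasDerivAt (halfAngleSeries (i + 1)) (u (i + 1) - halfAngleSeries i θ) θ := by
    simpa [u] using hasDerivAt_halfAngleSeries_succ hθ i
  refine (hasDerivAt_sum_antidiagonal_mul_pow h_zero h_succ (π / 2) n).congr_deriv ?_
  simp only [u, div_mul_eq_mul_div, sub_mul, ← Finset.sum_div, Finset.sum_sub_distrib]
  simp only [← div_mul_eq_mul_div, sum_antidiagonal_pow_div_factorial]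
  ring_nf

theorem tendsto_primitive_zero (n : ℕ) : Tendsto (primitive n) (𝓝[>] 0) (𝓝 0) := by
  have h : Tendsto (primitive n) (𝓝 0) (𝓝 (∑ p ∈ antidiagonal n,
      0 * (((0 : ℝ) - π / 2) ^ p.2 / p.2.factorial))) :=
    tendsto_finsetSum _ fun p _ => (tendsto_halfAngleSeries_zero p.1).mul
      (Continuous.tendsto (by fun_prop) 0)
  simp only [zero_mul, Finset.sum_const_zero] at h
  exact h.mono_left nhdsWithin_le_nhds

theorem tendsto_primitive_pi_div_two (n : ℕ) :
    Tendsto (primitive n) (𝓝[<] (π / 2)) (𝓝 (W (n + 1) n)) := by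
  have h : Tendsto (primitive n) (𝓝[<] (π / 2))
      (𝓝 (∑ p ∈ antidiagonal n,
        W (p.1 + 1) p.1 * ((π / 2 - π / 2) ^ p.2 / p.2.factorial))) :=
    tendsto_finsetSum _ fun p _ => (tendsto_halfAngleSeries_pi_div_two p.1).mul
      ((Continuous.tendsto (by fun_prop) _).mono_left nhdsWithin_le_nhds)
  have h_value : ∑ p ∈ antidiagonal n,
      W (p.1 + 1) p.1 * ((π / 2 - π / 2) ^ p.2 / p.2.factorial) = W (n + 1) n := by
    rw [Finset.sum_eq_single (n, 0)]
    · simp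
    · rintro ⟨i, s⟩ hp h_ne
      have hs : s ≠ 0 := by
        rintro rfl
        exact h_ne (Prod.ext (by simpa using hp) rfl)
      simp [hs]
    · simp
  rwa [h_value] at h

end Primitive

section Kernel

/-- The function `((π/2)^n - (π/2 - θ)^n) / (n! sin θ)`, extended continuously to `θ = 0`. -/
noncomputable def kernelFun (n : ℕ) (θ : ℝ) : ℝ :=
  (∑ i ∈ Finset.range n, (π / 2) ^ i * (π / 2 - θ) ^ (n - 1 - i)) / n.factorial /
    Real.sinc θ

theorem sinc_pos {θ : ℝ} (hθ : |θ| < π) : 0 < Real.sinc θ := by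
  rcases eq_or_ne θ 0 with rfl | h
  · simp
  · rw [Real.sinc_of_ne_zero h]
    obtain ⟨h_gt, h_lt⟩ := abs_lt.1 hθ
    rcases h.lt_or_gt with h_neg | h_pos
    · exact div_pos_of_neg_of_neg (Real.sin_neg_of_neg_of_neg_pi_lt h_neg h_gt) h_neg
    · exact div_pos (Real.sin_pos_of_pos_of_lt_pi h_pos h_lt) h_pos

theorem sinc_mul_self (θ : ℝ) : Real.sinc θ * θ = Real.sin θ := by
  rcases eq_or_ne θ 0 with rfl | h
  · simp
  · rw [Real.sinc_of_ne_zero h, div_mul_cancel₀ _ h]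

theorem abs_lt_pi_of_mem_Icc {θ : ℝ} (hθ : θ ∈ Set.Icc 0 (π / 2)) : |θ| < π := by
  rw [abs_of_nonneg hθ.1]
  linarith [hθ.2, Real.pi_pos]

theorem continuousOn_kernelFun (n : ℕ) :
    ContinuousOn (kernelFun n) (Set.Icc 0 (π / 2)) :=
  ContinuousOn.div (by fun_prop) Real.continuous_sinc.continuousOn fun _ hθ =>
    (sinc_pos (abs_lt_pi_of_mem_Icc hθ)).ne'

theorem intervalIntegrable_kernelFun (n : ℕ) :
    IntervalIntegrable (kernelFun n) MeasureTheory.volume 0 (π / 2) := by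
  refine ContinuousOn.intervalIntegrable ?_
  rw [Set.uIcc_of_le Real.pi_div_two_pos.le]
  exact continuousOn_kernelFun n

theorem kernelFun_mul_sin {θ : ℝ} (hθ : |θ| < π) (n : ℕ) :
    kernelFun n θ * Real.sin θ =
      ((π / 2) ^ n - (π / 2 - θ) ^ n) / n.factorial := by
  have h_sinc := (sinc_pos hθ).ne'
  rw [kernelFun, ← sinc_mul_self, ← geom_sum₂_mul, sub_sub_cancel]
  field_simp

theorem integral_kernelFun (n : ℕ) :
    ∫ θ in 0..(π / 2), kernelFun n θ = (-1) ^ n * W (n + 1) n := by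
  have h_deriv (θ : ℝ) (hθ : θ ∈ Set.Ioo 0 (π / 2)) :
      HasDerivAt (fun θ => (-1) ^ n * primitive n θ) (kernelFun n θ) θ := by
    have h_abs := abs_lt_pi_of_mem_Icc (Set.Ioo_subset_Icc_self hθ)
    have h_sin : Real.sin θ ≠ 0 :=
      (Real.sin_pos_of_pos_of_lt_pi hθ.1 (lt_of_abs_lt h_abs)).ne'
    refine ((hasDerivAt_primitive hθ n).const_mul ((-1) ^ n)).congr_deriv ?_
    rw [eq_comm, ← mul_div_assoc, eq_div_iff h_sin, kernelFun_mul_sin h_abs,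
      ← mul_div_assoc, mul_sub, ← mul_pow, ← mul_pow]
    ring_nf
  have h_zero := (tendsto_primitive_zero n).const_mul ((-1) ^ n)
  have h_pi := (tendsto_primitive_pi_div_two n).const_mul ((-1) ^ n)
  rw [intervalIntegral.integral_eq_sub_of_hasDerivAt_of_tendsto Real.pi_div_two_pos h_deriv
    (intervalIntegrable_kernelFun n) h_zero h_pi, mul_zero, sub_zero]

end Kernel

section RiemannLebesgue

theorem tendsto_integral_mul_cos {g : ℝ → ℝ} (hg : MeasureTheory.Integrable g) :
    Tendsto (fun w : ℝ => ∫ θ, g θ * Real.cos (w * θ)) (cocompact ℝ) (𝓝 0) := by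
  have h_scale : Tendsto (fun w : ℝ => w * (2 * π)⁻¹) (cocompact ℝ) (cocompact ℝ) :=
    (Homeomorph.mulRight₀ _ (by positivity)).isClosedEmbedding.tendsto_cocompact
  have h_fourier := (Complex.continuous_re.tendsto 0).comp
    ((Real.tendsto_integral_exp_smul_cocompact fun θ => (g θ : ℂ)).comp h_scale)
  refine h_fourier.congr fun w => ?_
  have h_int : MeasureTheory.Integrable fun θ : ℝ =>
      Real.fourierChar (-(θ * (w * (2 * π)⁻¹))) • (g θ : ℂ) := by
    simpa [mul_comm] using
      (Real.fourierIntegral_convergent_iff (w * (2 * π)⁻¹)).2 hg.ofReal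
  simp only [Function.comp_apply]
  refine (integral_re h_int).symm.trans (MeasureTheory.integral_congr_ae (.of_forall fun θ => ?_))
  have h_arg : 2 * π * -(θ * (w * (2 * π)⁻¹)) = -(w * θ) := by field_simp
  simp only [RCLike.re_to_complex, Circle.smul_def, Real.fourierChar_apply, smul_eq_mul]
  rw [Complex.re_mul_ofReal, Complex.exp_ofReal_mul_I_re, h_arg, Real.cos_neg, mul_comm]

theorem tendsto_setIntegral_mul_cos {g : ℝ → ℝ} {s : Set ℝ} (hs : MeasurableSet s)
    (hg : MeasureTheory.IntegrableOn g s) :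
    Tendsto (fun w : ℝ => ∫ θ in s, g θ * Real.cos (w * θ)) (cocompact ℝ) (𝓝 0) := by
  refine (tendsto_integral_mul_cos (hg.integrable_indicator hs)).congr fun w => ?_
  rw [← MeasureTheory.integral_indicator hs]
  simp only [Set.indicator_mul_left]

theorem tendsto_intervalIntegral_mul_cos {g : ℝ → ℝ} {a b : ℝ}
    (hg : IntervalIntegrable g MeasureTheory.volume a b) :
    Tendsto (fun w : ℝ => ∫ θ in a..b, g θ * Real.cos (w * θ)) (cocompact ℝ) (𝓝 0) := by
  simpa only [intervalIntegral, sub_zero] using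
    (tendsto_setIntegral_mul_cos measurableSet_Ioc hg.1).sub
      (tendsto_setIntegral_mul_cos measurableSet_Ioc hg.2)

end RiemannLebesgue

section SinMoment

/-- The sine moments of the kernel function, with the factor `sin θ` cleared from its
denominator. -/
noncomputable def sinMoment (n : ℕ) (k : ℝ) : ℝ :=
  ∫ θ in 0..(π / 2),
    ((π / 2) ^ n - (π / 2 - θ) ^ n) / n.factorial * Real.sin (k * θ)

theorem sin_mul_sum_sin_odd (θ : ℝ) (N : ℕ) :
    Real.sin θ * ∑ q ∈ Finset.range N, 2 * Real.sin ((2 * q + 1) * θ) =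
      1 - Real.cos (2 * N * θ) := by
  induction N with
  | zero => simp
  | succ N ih =>
    rw [Finset.sum_range_succ, mul_add, ih]
    push_cast
    rw [show 2 * ((N : ℝ) + 1) * θ = (2 * N + 1) * θ + θ by ring,
      show 2 * (N : ℝ) * θ = (2 * N + 1) * θ - θ by ring, Real.cos_add, Real.cos_sub]
    ring

theorem sum_two_mul_sinMoment (n N : ℕ) :
    ∑ q ∈ Finset.range N, 2 * sinMoment n (2 * q + 1) = (∫ θ in 0..(π / 2), kernelFun n θ) -
      ∫ θ in 0..(π / 2), kernelFun n θ * Real.cos (2 * N * θ) := by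
  have h_int := intervalIntegrable_kernelFun n
  rw [← intervalIntegral.integral_sub h_int (h_int.mul_continuousOn (by fun_prop))]
  simp only [sinMoment, ← intervalIntegral.integral_const_mul]
  rw [← intervalIntegral.integral_finsetSum fun q _ =>
    Continuous.intervalIntegrable (by fun_prop) _ _]
  refine intervalIntegral.integral_congr fun θ hθ => ?_
  rw [Set.uIcc_of_le Real.pi_div_two_pos.le] at hθ
  calc ∑ q ∈ Finset.range N, 2 * (((π / 2) ^ n - (π / 2 - θ) ^ n) / n.factorial *
        Real.sin ((2 * q + 1) * θ))
      = kernelFun n θ * (Real.sin θ * ∑ q ∈ Finset.range N, 2 * Real.sin ((2 * q + 1) * θ)) := by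
        rw [← mul_assoc, kernelFun_mul_sin (abs_lt_pi_of_mem_Icc hθ), Finset.mul_sum]
        exact Finset.sum_congr rfl fun q _ => mul_left_comm _ _ _
    _ = kernelFun n θ - kernelFun n θ * Real.cos (2 * N * θ) := by
        rw [sin_mul_sum_sin_odd, mul_sub, mul_one]

theorem tendsto_sum_sinMoment (n : ℕ) :
    Tendsto (fun N => ∑ q ∈ Finset.range N, 2 * sinMoment n (2 * q + 1)) atTop
      (𝓝 ((-1) ^ n * W (n + 1) n)) := by
  have h_frequency : Tendsto (fun N : ℕ => 2 * (N : ℝ)) atTop (cocompact ℝ) :=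
    (tendsto_natCast_atTop_atTop.const_mul_atTop two_pos).mono_right atTop_le_cocompact
  have h := ((tendsto_intervalIntegral_mul_cos (intervalIntegrable_kernelFun n)).comp
    h_frequency).const_sub (∫ θ in 0..(π / 2), kernelFun n θ)
  rw [sub_zero, integral_kernelFun] at h
  refine h.congr fun N => ?_
  rw [sum_two_mul_sinMoment, integral_kernelFun]
  rfl

theorem hasDerivAt_sin_const_mul (k θ : ℝ) :
    HasDerivAt (fun θ => Real.sin (k * θ)) (k * Real.cos (k * θ)) θ := by
  simpa [mul_comm] using ((hasDerivAt_id' θ).const_mul k).sin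

theorem hasDerivAt_cos_const_mul (k θ : ℝ) :
    HasDerivAt (fun θ => Real.cos (k * θ)) (-(k * Real.sin (k * θ))) θ := by
  simpa [mul_comm] using ((hasDerivAt_id' θ).const_mul k).cos

theorem hasDerivAt_const_sub_pow_div_factorial (b x : ℝ) (n : ℕ) :
    HasDerivAt (fun y : ℝ => (b - y) ^ (n + 1) / ((n + 1).factorial : ℝ))
      (-((b - x) ^ n / n.factorial)) x := by
  refine ((((hasDerivAt_id' x).const_sub b).fun_pow (n + 1)).div_const _).congr_deriv ?_
  rw [Nat.factorial_succ, Nat.add_sub_cancel]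
  push_cast
  field_simp

theorem ne_zero_of_cos_mul_eq_zero {k x : ℝ} (hk : Real.cos (k * x) = 0) : k ≠ 0 := by
  rintro rfl
  simp at hk

theorem integral_sin_const_mul {k : ℝ} (hk : Real.cos (k * (π / 2)) = 0) :
    ∫ θ in 0..(π / 2), Real.sin (k * θ) = 1 / k := by
  rw [intervalIntegral.integral_comp_mul_left _ (ne_zero_of_cos_mul_eq_zero hk), integral_sin, hk]
  simp

theorem sinMoment_zero (k : ℝ) : sinMoment 0 k = 0 := by simp [sinMoment]

theorem sinMoment_add_two {k : ℝ} (hk : Real.cos (k * (π / 2)) = 0) (n : ℕ) :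
    sinMoment (n + 2) k =
      ((π / 2) ^ n / n.factorial * (1 / k) - sinMoment n k) / k ^ 2 := by
  have hk₀ : k ≠ 0 := ne_zero_of_cos_mul_eq_zero hk
  have h_deriv (θ : ℝ) := (((hasDerivAt_const_sub_pow_div_factorial (π / 2) θ (n + 1)).sub_const
      ((π / 2) ^ (n + 2) / ((n + 2).factorial : ℝ))).mul
        (hasDerivAt_cos_const_mul k θ)).div_const k |>.add
    (((hasDerivAt_const_sub_pow_div_factorial (π / 2) θ n).mul
      (hasDerivAt_sin_const_mul k θ)).div_const (k ^ 2))
  have h_parts := intervalIntegral.integral_eq_sub_of_hasDerivAt (a := 0) (b := π / 2)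
    (fun θ _ => h_deriv θ) (Continuous.intervalIntegrable (by fun_prop) _ _)
  have h_zero : sinMoment (n + 2) k -
      ((π / 2) ^ n / n.factorial * (1 / k) - sinMoment n k) / k ^ 2 = 0 := by
    rw [sinMoment, sinMoment, ← integral_sin_const_mul hk, ← intervalIntegral.integral_const_mul,
      ← intervalIntegral.integral_sub, ← intervalIntegral.integral_div,
      ← intervalIntegral.integral_sub]
    · refine Eq.trans (intervalIntegral.integral_congr fun θ _ => ?_) (h_parts.trans ?_)
      · field_simp
        ring
      · simp [hk]
    all_goals exact Continuous.intervalIntegrable (by fun_prop) _ _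
  exact sub_eq_zero.1 h_zero

end SinMoment

section Evaluation

open PowerSeries

theorem sinMoment_two_mul_add_two {k : ℝ} (hk : Real.cos (k * (π / 2)) = 0) (m : ℕ) :
    (-1) ^ m * sinMoment (2 * m + 2) k =
      coeff m (PowerSeries.mk (fun i => 1 / k ^ (2 * i + 3)) *
        rescale (-(π / 2) ^ 2) coshSeries) := by
  have hk₀ : k ≠ 0 := ne_zero_of_cos_mul_eq_zero hk
  simp only [coeff_mul, coeff_mk, coeff_rescale, coshSeries]
  induction m with
  | zero =>
    rw [sinMoment_add_two hk, mul_zero, sinMoment_zero]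
    simp only [Finset.HasAntidiagonal.antidiagonal_zero, Finset.sum_singleton, mul_zero, pow_zero,
      Nat.factorial_zero, Nat.cast_one, inv_one, mul_one, div_one, one_mul, sub_zero, zero_add]
    field_simp
  | succ m ih =>
    have h_tail : ∀ x ∈ antidiagonal m,
        1 / k ^ (2 * (x.1 + 1) + 3) * ((-(π / 2) ^ 2) ^ x.2 * ((2 * x.2).factorial : ℝ)⁻¹) =
          1 / k ^ (2 * x.1 + 3) * ((-(π / 2) ^ 2) ^ x.2 * ((2 * x.2).factorial : ℝ)⁻¹) *
            (1 / k ^ 2) := fun x _ => by field_simp; ring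
    rw [Finset.Nat.sum_antidiagonal_succ, Finset.sum_congr rfl h_tail, ← Finset.sum_mul, ← ih,
      sinMoment_add_two hk, mul_add_one, neg_pow ((π / 2) ^ 2), ← pow_mul, mul_add_one]
    field_simp
    ring

theorem cos_odd_mul_pi_div_two (q : ℕ) : Real.cos ((2 * q + 1) * (π / 2)) = 0 :=
  Real.cos_eq_zero_iff.2 ⟨q, by push_cast; ring⟩

theorem hasSum_one_div_odd_pow {k : ℕ} (hk : 2 ≤ k) :
    HasSum (fun q : ℕ => 1 / (2 * (q : ℝ) + 1) ^ k) ((1 - 1 / 2 ^ k) * zetaVal k) := by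
  have h_all : Summable fun n : ℕ => 1 / (n : ℝ) ^ k := Real.summable_one_div_nat_pow.2 (by omega)
  have h_even : HasSum (fun q : ℕ => 1 / ((2 * q : ℕ) : ℝ) ^ k) (1 / 2 ^ k * zetaVal k) := by
    simp only [Nat.cast_mul, Nat.cast_ofNat, mul_pow, ← one_div_mul_one_div]
    exact h_all.hasSum.mul_left (1 / 2 ^ k)
  have h_odd : Summable fun q : ℕ => 1 / ((2 * q + 1 : ℕ) : ℝ) ^ k :=
    h_all.comp_injective (i := fun q : ℕ => 2 * q + 1) fun a b h => by simpa using h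
  have h_split := (HasSum.even_add_odd (f := fun n : ℕ => 1 / (n : ℝ) ^ k) h_even
    h_odd.hasSum).unique h_all.hasSum
  have h_value : ∑' q : ℕ, 1 / ((2 * q + 1 : ℕ) : ℝ) ^ k = (1 - 1 / 2 ^ k) * zetaVal k := by
    rw [sub_mul, one_mul]
    exact eq_sub_of_add_eq' h_split
  rw [← h_value]
  exact_mod_cast h_odd.hasSum

/-- The series `∑ 2 λ(2n + 3) Xⁿ`, where `λ(k) = ∑ 1 / (2q + 1)ᵏ = (1 - 2⁻ᵏ) ζ(k)`. -/
noncomputable def oddZetaSeries : ℝ⟦X⟧ :=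
  PowerSeries.mk fun n => 2 * ((1 - 1 / 2 ^ (2 * n + 3)) * zetaVal (2 * n + 3))

theorem W_eq_coeff (m : ℕ) :
    W (2 * m + 3) (2 * m + 2) =
      (-1) ^ m * coeff m (oddZetaSeries * rescale (-(π / 2) ^ 2) coshSeries) := by
  have h_lim : Tendsto
      (fun N => (-1) ^ m * ∑ q ∈ Finset.range N, 2 * sinMoment (2 * m + 2) (2 * q + 1)) atTop
      (𝓝 (coeff m (oddZetaSeries * rescale (-(π / 2) ^ 2) coshSeries))) := by
    simp only [coeff_mul, oddZetaSeries, coeff_mk]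
    refine (tendsto_finsetSum _ fun x _ => (((hasSum_one_div_odd_pow (k := 2 * x.1 + 3)
      (by omega)).tendsto_sum_nat.const_mul 2).mul_const _)).congr fun N => ?_
    simp only [Finset.mul_sum, Finset.sum_mul]
    rw [Finset.sum_comm]
    refine Finset.sum_congr rfl fun q _ => ?_
    rw [mul_left_comm, sinMoment_two_mul_add_two (cos_odd_mul_pi_div_two q), coeff_mul,
      Finset.mul_sum]
    simp only [coeff_mk, mul_assoc]
  have h := tendsto_nhds_unique ((tendsto_sum_sinMoment (2 * m + 2)).const_mul ((-1) ^ m)) h_lim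
  rw [← h, Even.neg_one_pow (n := 2 * m + 2) ⟨m + 1, by ring⟩, one_mul, ← mul_assoc, ← mul_pow]
  simp only [neg_mul_neg, one_mul, one_pow]

theorem coeff_oddZetaSeries_mul_zetaBarSeries (a : ℕ) :
    coeff a (oddZetaSeries * rescale (1 / 4 : ℝ) zetaBarSeries) =
      1 / 2 ^ (2 * (a + 1) - 1) * ∑ i ∈ Finset.Icc 1 (a + 1),
        (2 ^ (2 * i + 1) - 1) * zetaVal (2 * i + 1) * zetaBar (2 * (a + 1) - 2 * i) := by
  rw [sum_Icc_one_eq_sum_range, coeff_mul, Finset.Nat.sum_antidiagonal_eq_sum_range_succ_mk,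
    Finset.mul_sum]
  refine Finset.sum_congr rfl fun i hi => ?_
  obtain ⟨b, rfl⟩ := Nat.exists_eq_add_of_le (Finset.mem_range_succ_iff.1 hi)
  have h_four : (4 : ℝ) ^ b = 2 ^ (2 * b) := by rw [pow_mul]; norm_num
  dsimp only
  rw [Nat.add_sub_cancel_left, oddZetaSeries, zetaBarSeries, coeff_rescale, coeff_mk, coeff_mk,
    div_pow, h_four, one_pow, show 2 * (i + b + 1) - 1 = 2 * i + 2 * b + 1 by omega,
    show 2 * (i + b + 1) - 2 * (i + 1) = 2 * b by omega, show 2 * (i + 1) + 1 = 2 * i + 3 by ring]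
  field_simp
  ring

theorem W_eq_sum_zetaBar_mul_Z {p : ℕ} (hp : 1 ≤ p) :
    W (2 * p + 1) (2 * p) =
      (-1 : ℝ) ^ (p - 1) * ∑ j ∈ Finset.Icc 1 p,
        (1 / 2 ^ (2 * j - 1) * ∑ i ∈ Finset.Icc 1 j,
          (2 ^ (2 * i + 1) - 1) * zetaVal (2 * i + 1) * zetaBar (2 * j - 2 * i)) * Z j p := by
  obtain ⟨m, rfl⟩ := Nat.exists_eq_add_of_le' hp
  rw [show 2 * (m + 1) + 1 = 2 * m + 3 by ring, mul_add_one, W_eq_coeff, Nat.add_sub_cancel,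
    ← rescale_zetaBarSeries_mul_rescale_sinhcSeries, ← mul_assoc, coeff_mul,
    Finset.Nat.sum_antidiagonal_eq_sum_range_succ_mk, sum_Icc_one_eq_sum_range]
  refine congrArg _ (Finset.sum_congr rfl fun a ha => ?_)
  rw [coeff_oddZetaSeries_mul_zetaBarSeries, Z_eq_coeff (Finset.mem_range.1 ha),
    Nat.add_sub_add_right]

theorem W_mem_adjoin {p : ℕ} (hp : 1 ≤ p) :
    W (2 * p + 1) (2 * p) ∈
      Algebra.adjoin ℚ ({x : ℝ | ∃ k : ℕ, 2 ≤ k ∧ x = zetaVal k} ∪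
        {x : ℝ | ∃ k : ℕ, 1 ≤ k ∧ x = zetaBar k}) := by
  set A := Algebra.adjoin ℚ ({x : ℝ | ∃ k : ℕ, 2 ≤ k ∧ x = zetaVal k} ∪
    {x : ℝ | ∃ k : ℕ, 1 ≤ k ∧ x = zetaBar k})
  have h_rat (q : ℚ) : (q : ℝ) ∈ A := A.algebraMap_mem q
  have h_zeta {k : ℕ} (hk : 2 ≤ k) : zetaVal k ∈ A :=
    Algebra.subset_adjoin (Or.inl ⟨k, hk, rfl⟩)
  have h_zetaBar (n : ℕ) : zetaBar n ∈ A := by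
    rcases Nat.eq_zero_or_pos n with rfl | hn
    · simpa [zetaBar] using h_rat (1 / 2)
    · exact Algebra.subset_adjoin (Or.inr ⟨n, hn, rfl⟩)
  have h_inv_two_pow (n : ℕ) : (1 / 2 ^ n : ℝ) ∈ A := by
    simpa using h_rat (1 / 2 ^ n)
  have h_two_pow_sub_one (n : ℕ) : (2 ^ n - 1 : ℝ) ∈ A := by
    simpa using h_rat (2 ^ n - 1)
  rw [W_eq_sum_zetaBar_mul_Z hp]
  refine A.mul_mem (A.pow_mem (A.neg_mem A.one_mem) _) (A.sum_mem fun j _ =>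
    A.mul_mem (A.mul_mem (h_inv_two_pow _) (A.sum_mem fun i hi => ?_)) (Z_mem h_zetaBar _ _))
  have hi_one := (Finset.mem_Icc.1 hi).1
  exact A.mul_mem (A.mul_mem (h_two_pow_sub_one _) (h_zeta (by omega))) (h_zetaBar _)

end Evaluation

end AltMTV

/-- For every `p ≥ 1`: all the series `T̄(k₁, …, k_{2p})` in `W(2p+1, 2p)` converge; the value
`W(2p+1, 2p)` is a polynomial with rational coefficients in zeta values and alternating zeta
values; and explicitly it is given by the displayed formula. -/
theorem corollary3p5 (p : ℕ) (hp : 1 ≤ p) :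
    (∀ κ ∈ AltMTV.indices (2 * p + 1) (2 * p),
      Tendsto (AltMTV.tBarPartial κ) atTop (𝓝 (AltMTV.tBar κ))) ∧
    AltMTV.W (2 * p + 1) (2 * p) ∈
      Algebra.adjoin ℚ ({x : ℝ | ∃ k : ℕ, 2 ≤ k ∧ x = AltMTV.zetaVal k} ∪
        {x : ℝ | ∃ k : ℕ, 1 ≤ k ∧ x = AltMTV.zetaBar k}) ∧
    AltMTV.W (2 * p + 1) (2 * p) =
      (-1 : ℝ) ^ (p - 1) * ∑ j ∈ Finset.Icc 1 p,
        (1 / 2 ^ (2 * j - 1) * ∑ i ∈ Finset.Icc 1 j,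
          (2 ^ (2 * i + 1) - 1) * AltMTV.zetaVal (2 * i + 1) * AltMTV.zetaBar (2 * j - 2 * i)) *
          AltMTV.Z j p := by
  refine ⟨?_, AltMTV.W_mem_adjoin hp, AltMTV.W_eq_sum_zetaBar_mul_Z hp⟩
  obtain ⟨m, rfl⟩ := Nat.exists_eq_add_of_le' hp
  exact fun _ => AltMTV.tendsto_tBarPartial
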